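/- **Setting.** Let $D\subseteq\mathbb R$ be a Borel set, $\rho$ a probability measure on $D$, and $K:D\times D\to\mathbb R$ a measurable, non-trivial reproducing kernel with an anchor $c\in D$, i.e. $K(c,c)=0$. Assume $$M:=\int_D K(x,x)\,\rho(dx)<\infty,\qquad C_0:=\int_D\int_D K(x,y)\,\rho(dx)\,\rho(dy)>0 .$$ Let $\mathcal U$ be the set of finite subsets of $\mathbb N$. For a finite coordinate set $u$ let $K_u(x,y)=\prod_{j\in u}K(x_j,y_j)$ (with $K_\emptyset=1$) and let $H_u$ be the reproducing kernel Hilbert space of functions on $D^u$ with kernel $K_u$. Let $\gamma=(\gamma_u)_{u\in\mathcal U}$ be non-negative weights with $\sum_{u}\gamma_uM^{|u|}<\infty$, put $\mathcal A=\{u\in\mathcal U:\gamma_u>0\}$, and assume that $\mathcal A$ contains a non-empty set. Let $\mathcal H_\gamma$ be the reproducing kernel Hilbert space with kernel $\sum_{u\in\mathcal A}\gamma_uK_u(x,y)$ on $\mathfrak X=\{x\in D^{\mathbb N}:\sum_{u\in\mathcal A}\gamma_uK_u(x,x)<\infty\}$, with norm $\|\cdot\|_\gamma$, and let $I(f)=\int_{\mathfrak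 X}f\,d\mu$, where $\mu=\rho^{\mathbb N}$ is the infinite product measure. **Algorithms and cost.** Algorithms are of the form $Q(f)=\sum_{i=1}^n a_i f(t_{v_i};c)$ with $n\ge0$, $a_i\in\mathbb R$, $v_i\in\mathcal U$ and $t_{v_i}\in(D\setminus\{c\})^{v_i}$, where $(t_v;c)\in D^{\mathbb N}$ has the coordinates of $t_v$ on $v$ and the coordinate $c$ elsewhere. Let $e(Q)=\sup_{\|f\|_\gamma\le1}|I(f)-Q(f)|$. Let $\$:\{0,1,2,\dots\}\to[1,\infty)$ be non-decreasing; in the unrestricted subspace sampling model the cost of $Q$ is $\mathrm{cost}(Q)=\sum_{i=1}^n\$(|v_i|)$. Put $\mathrm{comp}(\varepsilon)=\inf\{\mathrm{cost}(Q): e(Q)\le\varepsilon\}$, and let $p^{\mathrm{unr}}\in[0,\infty]$ be the infimum of all $p\ge0$ for which there is a constant $A\ge0$ with $\mathrm{comp}(\varepsilon)\le A\varepsilon^{-p}$ for all $\varepsilon>0$ ($p^{\mathrm{unr}}=\infty$ if there is no such $p$). **Weights.** Let $\widehat\gamma_u=\gamma_uC_0^{|u|}$, let $u_1,u_2,\dots$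 be the non-empty sets in $\mathcal A$, ordered such that $\widehat\gamma_{u_1}\ge\widehat\gamma_{u_2}\ge\cdots$ (with $\widehat\gamma_{u_j}:=0$ for large $j$ if there are only finitely many), and let $$\mathrm{decay}_\gamma=\sup\{p\in\mathbb R:\lim_{j\to\infty}\widehat\gamma_{u_j}j^p=0\}\in[1,\infty].$$ The algorithmic dimension of a set $\mathcal W\subseteq\mathcal U$ is the smallest $d\in\mathbb N$ such that there is a map $\phi:\mathbb N\to\{1,\dots,d\}$ that is injective on every $u\in\mathcal W$ (and it is $\infty$ if there is no such $d$). **Theorem.** Let $\$(k)=O(k^s)$ for some $s\ge0$. Let $\mathcal W\subseteq\mathcal U$ with $\mathcal A\subseteq\mathcal W$ have finite algorithmic dimension $d$ (for instance $\mathcal W=\mathcal A$, if the weights have finite algorithmic dimension), and let $\mathrm{decay}_\gamma>1$. Assume that there are $\alpha>0$, constants $b,B,\beta_1,\beta_2\ge0$ and, for every $n\ge1$, coefficients $a^{(n)}_1,\dots,a^{(n)}_n\in\mathbb R$ and points $t^{(1,n)},\dots,t^{(n,n)}\in D^d$ such that for all $u\subseteq\{1,\dots,d\}$ $$\sup_{\|g\|_{H_u}\le1}\Bigl|\int_{D^u}g\,d\rho^u-\sum_{i=1}^na^{(n)}_i\,g\bigl(t^{(i,n)}_u\bigr)\Bigr|\le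 b\,B^{|u|}(n+1)^{-\alpha}\bigl(1+\ln(n+1)\bigr)^{\beta_1|u|+\beta_2}.$$ Then $$p^{\mathrm{unr}}\le\max\left\{\frac1\alpha,\ \frac{2\min\{1,s\}}{\mathrm{decay}_\gamma-1}\right\},$$ where the second term is $0$ if $\mathrm{decay}_\gamma=\infty$. -/

import Mathlib

open MeasureTheory Filter Topology
open scoped ENNReal NNReal

noncomputable section

namespace InfDimInt

/-! ### Scalar reproducing kernels and the worst case integration error -/

/-- A real reproducing kernel on `X`: a symmetric, positive semidefinite function `X × X → ℝ`
(for all finitely supported real families, `∑ i, ∑ j, aᵢ k(xᵢ, xⱼ) aⱼ ≥ 0`). -/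
structure RKernel (X : Type*) where
  toFun : X → X → ℝ
  posSemidef : (Matrix.of toFun).PosSemidef

namespace RKernel

variable {X Y : Type*}

instance : CoeFun (RKernel X) (fun _ => X → X → ℝ) := ⟨RKernel.toFun⟩

theorem symm (k : RKernel X) (x y : X) : k x y = k y x := by
  have h := k.posSemidef.1.apply x y
  simpa using h.symm

theorem diag_nonneg (k : RKernel X) (x : X) : 0 ≤ k x x := by
  simpa using k.posSemidef.diag_nonneg (i := x)

theorem quad_nonneg (k : RKernel X) (x y : X) (a b : ℝ) :
    0 ≤ a * k x x * a + a * k x y * b + (b * k y x * a + b * k y y * b) := by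
  have h := (k.posSemidef.submatrix ![x, y]).dotProduct_mulVec_nonneg ![a, b]
  simp [Matrix.mulVec, dotProduct, Fin.sum_univ_two] at h
  nlinarith [h]

theorem two_abs_le (k : RKernel X) (x y : X) : 2 * |k x y| ≤ k x x + k y y := by
  have h1 := k.quad_nonneg x y 1 1
  have h2 := k.quad_nonneg x y 1 (-1)
  rw [k.symm y x] at h1 h2
  rcases abs_cases (k x y) with ⟨h, _⟩ | ⟨h, _⟩ <;> rw [h] <;> linarith

theorem eq_zero_of_diag (k : RKernel X) {x y : X} (hy : k y y = 0) : k x y = 0 := by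
  have h : ∀ b : ℝ, 0 ≤ k x x + 2 * b * k x y := fun b => by
    have := k.quad_nonneg x y 1 b
    rw [k.symm y x, hy] at this
    linarith
  by_contra hne
  have := h (-(k x x + 1) / (2 * k x y))
  field_simp at this
  linarith

/-- The kernel `k`, read as an operator-valued kernel with values in `ℝ →L[ℝ] ℝ`. -/
def op (k : RKernel X) : Matrix X X (ℝ →L[ℝ] ℝ) :=
  Matrix.of fun x y => k x y • ContinuousLinearMap.id ℝ ℝ

instance op_posSemidef (k : RKernel X) : Fact k.op.PosSemidef := by
  have key : k.op.PosSemidef ↔ k.op.IsHermitian ∧ ∀ v : X →₀ ℝ, 0 ≤ RCLike.re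
      (v.sum fun x w => v.sum fun x' w' => inner ℝ (k.op x' x w) w') :=
    (RKHS.posSemidef_tfae (𝕜 := ℝ) (K := k.op)).out 0 2
  refine ⟨key.mpr ⟨?_, fun v => ?_⟩⟩
  · refine Matrix.IsHermitian.ext fun i j => ?_
    simp only [op, Matrix.of_apply, k.symm j i, star_smul]
    congr 1
    exact star_one _
  · have h := k.posSemidef.2 v
    simp only [op, Matrix.of_apply, _root_.smul_apply, ContinuousLinearMap.id_apply,
      smul_eq_mul]
    simp only [Matrix.of_apply, star_trivial] at h
    refine h.trans_eq ?_
    simp only [Finsupp.sum, RCLike.inner_apply, conj_trivial, RCLike.re_to_real]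
    refine Finset.sum_congr rfl fun i _ => Finset.sum_congr rfl fun j _ => ?_
    rw [k.symm j i]
    ring

/-- The reproducing kernel Hilbert space `H(k)`, a Hilbert space of functions `X → ℝ`. -/
abbrev Space (k : RKernel X) : Type _ := RKHS.OfKernel k.op

/-- The product kernel `K_u(x, y) = ∏_{j ∈ u} k(x_j, y_j)` on `X^ι`; the empty product is `1`. -/
def tensor {ι : Type*} (k : RKernel X) (u : Finset ι) : RKernel (ι → X) where
  toFun x y := ∏ j ∈ u, k (x j) (y j)
  posSemidef := by
    classical
    induction u using Finset.induction_on with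
    | empty =>
      refine ⟨?_, fun v => ?_⟩
      · ext; simp
      · simp only [Finset.prod_empty, Matrix.of_apply, mul_one, star_trivial]
        simp only [Finsupp.sum, ← Finset.mul_sum, ← Finset.sum_mul]
        exact mul_self_nonneg _
    | insert i u hi ih =>
      have := (k.posSemidef.submatrix (fun x : ι → X => x i)).hadamard ih
      have he : (Matrix.of fun x y : ι → X => ∏ j ∈ insert i u, k (x j) (y j)) =
          ((Matrix.of k.toFun).submatrix (fun x : ι → X => x i) (fun x => x i)).hadamard
            (Matrix.of fun x y : ι → X => ∏ j ∈ u, k (x j) (y j)) := by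
        ext x y
        simp [Finset.prod_insert hi]
      rw [he]
      exact this

@[simp] theorem tensor_apply {ι : Type*} (k : RKernel X) (u : Finset ι) (x y : ι → X) :
    k.tensor u x y = ∏ j ∈ u, k (x j) (y j) := rfl

/-- The worst case error over the unit ball of `H(k)`,
`sup_{‖f‖ ≤ 1} |∫ f dμ - ∑ᵢ aᵢ f(tᵢ)|`, of the quadrature with coefficients `a` and points `t`. -/
def worstCaseError [MeasurableSpace X] (k : RKernel X) (μ : Measure X) {n : ℕ}
    (a : Fin n → ℝ) (t : Fin n → X) : ℝ≥0∞ :=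
  ⨆ (f : k.Space) (_ : ‖f‖ ≤ 1), ENNReal.ofReal |∫ x, f x ∂μ - ∑ i, a i * f (t i)|

end RKernel

/-! ### Anchored kernels and weighted spaces of functions of infinitely many variables -/

/-- A measurable, non-trivial reproducing kernel on `D ⊆ ℝ` with anchor `c ∈ D`. -/
structure AnchoredKernel (D : Set ℝ) extends RKernel D where
  measurable : Measurable (Function.uncurry toFun)
  anchor : D
  anchored : toFun anchor anchor = 0
  nontrivial : ∃ x y, toFun x y ≠ 0

namespace AnchoredKernel

variable {D : Set ℝ}

/-- `M = ∫ K(x, x) ρ(dx)`. -/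
def diagIntegral (K : AnchoredKernel D) (ρ : Measure D) : ℝ := ∫ x, K.toFun x x ∂ρ

/-- `C₀ = ∫ ∫ K(x, y) ρ(dx) ρ(dy)`. -/
def doubleIntegral (K : AnchoredKernel D) (ρ : Measure D) : ℝ :=
  ∫ y, ∫ x, K.toFun x y ∂ρ ∂ρ

/-- For a coordinate set `u` (of natural numbers, or of elements of `{1, …, d}`), the worst case
error over `H_u`, the space of functions on `D^u` with kernel `∏_{j ∈ u} K(x_j, y_j)`, of the
quadrature `g ↦ ∑ᵢ aᵢ g((tᵢ)_u)` for integration with respect to `ρ^u`. -/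
def errorOn {ι : Type*} (K : AnchoredKernel D) (ρ : Measure D) (u : Finset ι) {n : ℕ}
    (a : Fin n → ℝ) (t : Fin n → ι → D) : ℝ≥0∞ :=
  (K.toRKernel.tensor (Finset.univ : Finset u)).worstCaseError
    (Measure.pi fun _ => ρ) a (fun i j => t i j)

/-- The domain of functions of infinitely many variables: all `x ∈ D^ℕ` with
`∑_u γ_u K_u(x, x) < ∞` (only sets with `γ_u > 0` contribute). -/
def domain (K : AnchoredKernel D) (γ : Finset ℕ → ℝ≥0) : Set (ℕ → D) :=
  {x | Summable fun u => (γ u : ℝ) * K.toRKernel.tensor u x x}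

theorem summable_of_mem_domain (K : AnchoredKernel D) (γ : Finset ℕ → ℝ≥0)
    (x y : K.domain γ) :
    Summable fun u => (γ u : ℝ) * K.toRKernel.tensor u (x : ℕ → D) (y : ℕ → D) := by
  refine Summable.of_norm_bounded (x.2.add y.2) fun u => ?_
  rw [Real.norm_eq_abs, abs_mul, abs_of_nonneg (γ u).coe_nonneg, ← mul_add]
  refine mul_le_mul_of_nonneg_left ?_ (γ u).coe_nonneg
  have h := (K.toRKernel.tensor u).two_abs_le (x : ℕ → D) (y : ℕ → D)
  have h' := abs_nonneg (K.toRKernel.tensor u (x : ℕ → D) (y : ℕ → D))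
  linarith

/-- The weighted kernel `𝒦_γ(x, y) = ∑_u γ_u K_u(x, y)` on `domain`. -/
def weighted (K : AnchoredKernel D) (γ : Finset ℕ → ℝ≥0) : RKernel (K.domain γ) where
  toFun x y := ∑' u, (γ u : ℝ) * K.toRKernel.tensor u (x : ℕ → D) (y : ℕ → D)
  posSemidef := by
    refine ⟨?_, fun v => ?_⟩
    · ext x y
      simp only [Matrix.conjTranspose_apply, Matrix.of_apply, star_trivial]
      exact tsum_congr fun u => by rw [(K.toRKernel.tensor u).symm]
    · have hs : HasSum (fun w : Finset ℕ => ∑ x ∈ v.support, ∑ y ∈ v.support,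
          v x * ((γ w : ℝ) * K.toRKernel.tensor w (x : ℕ → D) (y : ℕ → D)) * v y)
          (∑ x ∈ v.support, ∑ y ∈ v.support,
          v x * (∑' w, (γ w : ℝ) * K.toRKernel.tensor w (x : ℕ → D) (y : ℕ → D)) * v y) :=
        hasSum_sum fun x _ => hasSum_sum fun y _ =>
          ((K.summable_of_mem_domain γ x y).hasSum.mul_left _).mul_right _
      refine hs.nonneg fun w => ?_
      have h := ((K.toRKernel.tensor w).posSemidef.submatrix
        (fun x : K.domain γ => (x : ℕ → D))).2 v
      simp only [Finsupp.sum, Matrix.submatrix_apply, Matrix.of_apply, star_trivial] at h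
      have h2 := mul_nonneg (γ w).coe_nonneg h
      rw [Finset.mul_sum] at h2
      refine h2.trans_eq (Finset.sum_congr rfl fun x _ => ?_)
      rw [Finset.mul_sum]
      exact Finset.sum_congr rfl fun y _ => by ring

/-- A point all of whose coordinates outside a finite set `v` equal the anchor is in `domain`. -/
theorem mem_domain_of_finite (K : AnchoredKernel D) (γ : Finset ℕ → ℝ≥0) (v : Finset ℕ)
    (x : ℕ → D) (hx : ∀ j ∉ v, x j = K.anchor) : x ∈ K.domain γ := by
  refine summable_of_ne_finset_zero (s := v.powerset) fun u hu => ?_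
  rw [Finset.mem_powerset, Finset.not_subset] at hu
  obtain ⟨j, hju, hjv⟩ := hu
  refine mul_eq_zero_of_right _ (Finset.prod_eq_zero hju ?_)
  rw [hx j hjv]
  exact K.anchored

end AnchoredKernel

/-! ### Algorithms, cost and complexity in the unrestricted subspace sampling model -/

/-- An algorithm `Q(f) = ∑_{i=1}^n aᵢ f(t_{vᵢ}; c)` with finite coordinate sets `vᵢ` and points
`t_{vᵢ} ∈ (D \ {c})^{vᵢ}`; `n = 0` is the zero algorithm. -/
structure Algorithm {D : Set ℝ} (c : D) where
  n : ℕ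
  v : Fin n → Finset ℕ
  t : ∀ i, v i → D
  t_ne : ∀ i j, t i j ≠ c
  a : Fin n → ℝ

namespace Algorithm

variable {D : Set ℝ}

/-- The sample point `(t_{vᵢ}; c) ∈ D^ℕ`. -/
def point {c : D} (Q : Algorithm c) (i : Fin Q.n) : ℕ → D :=
  fun j => if h : j ∈ Q.v i then Q.t i ⟨j, h⟩ else c

/-- The worst case error `sup_{‖f‖_γ ≤ 1} |I(f) - Q(f)|`, where `I` is integration over the domain
with respect to the restriction of the infinite product measure `ρ^ℕ`. -/
def error (K : AnchoredKernel D) (ρ : Measure D) (γ : Finset ℕ → ℝ≥0)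
    (Q : Algorithm K.anchor) : ℝ≥0∞ :=
  (K.weighted γ).worstCaseError
    ((Measure.infinitePi fun _ : ℕ => ρ).comap Subtype.val) Q.a
    (fun i => ⟨Q.point i, K.mem_domain_of_finite γ (Q.v i) (Q.point i)
      (fun _ hj => dif_neg hj)⟩)

/-- The cost `∑ᵢ $(|vᵢ|)` in the unrestricted subspace sampling model. -/
def cost {c : D} (price : ℕ → ℝ) (Q : Algorithm c) : ℝ := ∑ i, price (Q.v i).card

end Algorithm

/-- The `ε`-complexity in the unrestricted subspace sampling model: the infimum of the costs of
all algorithms with worst case error at most `ε`. -/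
def complexity {D : Set ℝ} (K : AnchoredKernel D) (ρ : Measure D) (γ : Finset ℕ → ℝ≥0)
    (price : ℕ → ℝ) (ε : ℝ) : ℝ≥0∞ :=
  ⨅ (Q : Algorithm K.anchor) (_ : Q.error K ρ γ ≤ ENNReal.ofReal ε),
    ENNReal.ofReal (Q.cost price)

/-- The exponent of strong tractability in the unrestricted subspace sampling model: the infimum of
all `p ≥ 0` such that, for some `A ≥ 0`, the `ε`-complexity is at most `A ε^{-p}` for all `ε > 0`.
It is `⊤` if there is no such `p`. -/
def exponent {D : Set ℝ} (K : AnchoredKernel D) (ρ : Measure D) (γ : Finset ℕ → ℝ≥0)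
    (price : ℕ → ℝ) : EReal :=
  sInf {q | ∃ p : ℝ, q = p ∧ 0 ≤ p ∧ ∃ A : ℝ, 0 ≤ A ∧
    ∀ ε : ℝ, 0 < ε → complexity K ρ γ price ε ≤ ENNReal.ofReal (A * ε ^ (-p))}

/-! ### Weights -/

/-- `w (e j)`, or `0` if `e j = ∅`. -/
def orderedWeight (w : Finset ℕ → ℝ) (e : ℕ → Finset ℕ) (j : ℕ) : ℝ :=
  if (e j).Nonempty then w (e j) else 0

/-- The sequence `e` lists every non-empty set of positive weight exactly once, in an order of
non-increasing weights; if there are only finitely many such sets, then the list is continued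
with `∅`. -/
structure IsOrdering (w : Finset ℕ → ℝ) (e : ℕ → Finset ℕ) : Prop where
  pos : ∀ j, (e j).Nonempty → 0 < w (e j)
  surj : ∀ u : Finset ℕ, u.Nonempty → 0 < w u → ∃ j, e j = u
  inj : ∀ i j, (e i).Nonempty → e i = e j → i = j
  anti : Antitone (orderedWeight w e)

/-- The decay of the weights `w`: the supremum of all `p ∈ ℝ` such that `w(u_j) j^p → 0`, where
`u₁, u₂, …` are the non-empty sets of positive weight, in an order of non-increasing weights
(the sequence `w(u_1), w(u_2), …` does not depend on the choice of the order). -/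
def decay (w : Finset ℕ → ℝ) : EReal :=
  sSup {q | ∃ p : ℝ, q = p ∧ ∃ e, IsOrdering w e ∧
    Tendsto (fun j : ℕ => orderedWeight w e j * ((j : ℝ) + 1) ^ p) atTop (𝓝 0)}

/-- The algorithmic dimension of a family `W` of finite coordinate sets: the smallest `d` for which
there is a map `φ : ℕ → {1, …, d}` that is injective on each `u ∈ W`; `⊤` if there is none. -/
def algorithmicDim (W : Set (Finset ℕ)) : ℕ∞ :=
  sInf {q | ∃ d : ℕ, q = d ∧ ∃ φ : ℕ → Fin d, ∀ u ∈ W, Set.InjOn φ (u : Set ℕ)}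

end InfDimInt

end

open InfDimInt

namespace InfDimInt

/-! The worst case error is the norm of a Riesz representer, so its square is a quadratic expression
in the kernel. The weighted kernel is a sum over `u`; hence e(Q)² = ∑ γ_u e_u(Q)², where e_u is the
error over H_u (`Algorithm.error_le_of_tsum_le`).

Because K(·, c) = 0, a product of kernel factors over `u` vanishes at a point anchored outside `w`
unless u ⊆ w (`Algorithm.prod_anchorOutside`). Signed combinations of anchored quadratures can
therefore act on each H_u as one prescribed quadrature. A map φ that is injective on every active
set pulls the given points in D^d back to D^ℕ without changing these errors
(`AnchoredKernel.coordSqError_comp`), and it forces |u| ≤ d.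

Number the active sets by J with γ_u ≤ G J(u)^(-p), assign the sets with 2^k ≤ J(u) < 2^(k+1) to
level k, and use N_k ≈ 2^(κ(m-k)) points there for k ≤ m. There are two ways to do this. Telescoping
over the unions of the levels samples on O(2^k) coordinates, at price O(2^(ks)) per point. Treating
each set separately by inclusion-exclusion costs O(1) per point and set, for O(2^k) sets. The
cheaper one costs a constant times ∑ N_k 2^(kσ), σ = min(1, s)
(`AnchoredKernel.exists_isMultilevel`).

With 2σ/q < r < p - 1 and κ = r/(2α), the squared error is O(2^(-rm)) times the convergent sum of
J(u)^(-(p-r)), and the cost is O(2^(rqm/2)) as soon as q > 1/α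
(`AnchoredKernel.exists_complexity_le`). So the complexity is O(ε^(-q)), and p may be taken
arbitrarily close to the decay. -/

/-- The linear functional `g ↦ ∑ᵢ aᵢ g(tᵢ)`. -/
def quadrature {X κ : Type*} [Fintype κ] (a : κ → ℝ) (t : κ → X) : (X → ℝ) →ₗ[ℝ] ℝ where
  toFun g := ∑ i, a i * g (t i)
  map_add' g h := by simp [mul_add, Finset.sum_add_distrib]
  map_smul' c g := by
    simp only [Pi.smul_apply, smul_eq_mul, RingHom.id_apply, Finset.mul_sum]
    exact Finset.sum_congr rfl fun i _ => by ring

theorem quadrature_apply {X κ : Type*} [Fintype κ] (a : κ → ℝ) (t : κ → X) (g : X → ℝ) :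
    quadrature a t g = ∑ i, a i * g (t i) := rfl

/-! ### Worst case integration errors in a reproducing kernel Hilbert space -/

namespace RKernel

variable {X : Type*}

/-- The kernel section `k(·, y)` as an element of `H(k)`. -/
noncomputable def kernelSection (k : RKernel X) (y : X) : k.Space := RKHS.kerFun k.Space y (1 : ℝ)

theorem kernelSection_apply (k : RKernel X) (x y : X) : k.kernelSection y x = k x y := by
  rw [kernelSection, RKHS.kerFun_apply, RKHS.OfKernel.kernel_ofKernel]
  simp [op]

theorem inner_kernelSection (k : RKernel X) (f : k.Space) (y : X) :
    inner ℝ f (k.kernelSection y) = f y := by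
  rw [kernelSection, RKHS.inner_kerFun]
  simp

theorem norm_kernelSection (k : RKernel X) (y : X) : ‖k.kernelSection y‖ ^ 2 = k y y := by
  rw [← real_inner_self_eq_norm_sq, inner_kernelSection, kernelSection_apply]

/-- Cauchy-Schwarz, with √t ≤ 1 + t in place of the root, so that integrability of the diagonal
alone dominates every f. -/
theorem abs_apply_le (k : RKernel X) (f : k.Space) (y : X) :
    |f y| ≤ ‖f‖ * (1 + k y y) := by
  rw [← inner_kernelSection]
  refine (abs_real_inner_le_norm _ _).trans (mul_le_mul_of_nonneg_left ?_ (norm_nonneg _))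
  rw [← norm_kernelSection]
  nlinarith [sq_nonneg (‖k.kernelSection y‖ - 1)]

/-- Kernel sections span a dense subspace and evaluations are continuous, so f is a pointwise limit
of a sequence of measurable combinations of sections. -/
theorem measurable_coe [MeasurableSpace X] (k : RKernel X) (hk : ∀ y, Measurable fun x => k x y)
    (f : k.Space) : Measurable f := by
  have hf : f ∈ closure ((Submodule.span ℝ {RKHS.kerFun k.Space x v | (x) (v)} :
      Submodule ℝ k.Space) : Set k.Space) := by
    have := RKHS.kerFun_dense k.Space
    rw [← Submodule.topologicalClosure_coe, this]
    trivial
  obtain ⟨g, hg, hlim⟩ := mem_closure_iff_seq_limit.mp hf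
  refine measurable_of_tendsto_metrizable (f := fun n => (g n : X → ℝ)) (fun n => ?_) ?_
  · refine Submodule.span_induction (p := fun (h : k.Space) _ => Measurable (h : X → ℝ)) ?_ ?_ ?_ ?_
      (SetLike.mem_coe.mp (hg n))
    · rintro _ ⟨y, v, rfl⟩
      have : (RKHS.kerFun k.Space y v : X → ℝ) = fun x => v * k x y := by
        funext x
        rw [RKHS.kerFun_apply, RKHS.OfKernel.kernel_ofKernel]
        simp [op, mul_comm]
      rw [this]
      exact (hk y).const_mul v
    · rw [RKHS.coe_zero]; exact measurable_const
    · intro p q _ _ hp hq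
      rw [RKHS.coe_add]; exact hp.add hq
    · intro c p _ hp
      rw [RKHS.coe_smul]; exact hp.const_smul c
  · exact tendsto_pi_nhds.mpr fun x => ((RKHS.continuous_eval x).tendsto f).comp hlim

theorem integrable_coe [MeasurableSpace X] (k : RKernel X) (hk : ∀ y, Measurable fun x => k x y)
    (μ : Measure X) [IsFiniteMeasure μ] (hd : Integrable (fun x => k x x) μ) (f : k.Space) :
    Integrable f μ := by
  refine (((integrable_const (1 : ℝ)).add hd).const_mul ‖f‖).mono'
    (k.measurable_coe hk f).aestronglyMeasurable (ae_of_all _ fun x => ?_)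
  exact k.abs_apply_le f x

theorem integrable_section [MeasurableSpace X] (k : RKernel X)
    (hk : ∀ y, Measurable fun x => k x y) (μ : Measure X) [IsFiniteMeasure μ]
    (hd : Integrable (fun x => k x x) μ) (y : X) : Integrable (fun x => k x y) μ := by
  refine (k.integrable_coe hk μ hd (k.kernelSection y)).congr (ae_of_all _ fun x => ?_)
  exact k.kernelSection_apply x y

/-- The bound is linear in the diagonal, so after weighting and summation over `u` it is controlled
by ∑ γ_u M^|u| and by the condition that y lies in the domain. -/
theorem two_mul_integral_abs_le [MeasurableSpace X] (k : RKernel X)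
    (hk : ∀ y, Measurable fun x => k x y) (μ : Measure X) [IsProbabilityMeasure μ]
    (hd : Integrable (fun x => k x x) μ) (y : X) :
    2 * ∫ x, |k x y| ∂μ ≤ ∫ x, k x x ∂μ + k y y := by
  rw [← integral_const_mul]
  refine (integral_mono ((k.integrable_section hk μ hd y).abs.const_mul 2)
    (hd.add (integrable_const (k y y))) fun x => k.two_abs_le x y).trans (le_of_eq ?_)
  simp only [Pi.add_apply]
  rw [integral_add hd (integrable_const _), integral_const]
  simp

theorem two_abs_integral_le [MeasurableSpace X] (k : RKernel X)
    (hk : ∀ y, Measurable fun x => k x y) (μ : Measure X) [IsProbabilityMeasure μ]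
    (hd : Integrable (fun x => k x x) μ) (y : X) :
    2 * |∫ x, k x y ∂μ| ≤ ∫ x, k x x ∂μ + k y y :=
  (mul_le_mul_of_nonneg_left abs_integral_le_integral_abs zero_le_two).trans
    (k.two_mul_integral_abs_le hk μ hd y)

/-- The squared worst case error of the functional `L` for integration with respect to `μ`, in
terms of the kernel. -/
noncomputable def sqError [MeasurableSpace X] (k : RKernel X) (μ : Measure X)
    (L : (X → ℝ) →ₗ[ℝ] ℝ) : ℝ :=
  ∫ y, ∫ x, k x y ∂μ ∂μ - 2 * L (fun y => ∫ x, k x y ∂μ) + L fun y => L fun x => k x y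

/-- The error functional `f ↦ ∫ f dμ - ∑ᵢ aᵢ f(tᵢ)` has a representer in `H(k)`. -/
theorem exists_representer [MeasurableSpace X] (k : RKernel X)
    (hk : ∀ y, Measurable fun x => k x y) (μ : Measure X) [IsFiniteMeasure μ]
    (hd : Integrable (fun x => k x x) μ) {n : ℕ} (a : Fin n → ℝ) (t : Fin n → X) :
    ∃ r : k.Space, ∀ f : k.Space, inner ℝ r f = ∫ x, f x ∂μ - quadrature a t f := by
  let E : k.Space →ₗ[ℝ] ℝ :=
    { toFun := fun f => ∫ x, f x ∂μ - quadrature a t f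
      map_add' := fun f g => by
        simp only [RKHS.coe_add, Pi.add_apply, map_add]
        rw [integral_add (k.integrable_coe hk μ hd f) (k.integrable_coe hk μ hd g)]
        ring
      map_smul' := fun c f => by
        simp only [RKHS.coe_smul, Pi.smul_apply, map_smul, RingHom.id_apply, integral_smul]
        rw [smul_sub] }
  have hb : ∀ f, ‖E f‖ ≤ (∫ x, (1 + k x x) ∂μ + ∑ i, |a i| * (1 + k (t i) (t i))) * ‖f‖ := by
    intro f
    refine (norm_sub_le _ _).trans ?_
    rw [add_mul]
    refine add_le_add ?_ ?_
    · rw [mul_comm, ← integral_const_mul]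
      exact norm_integral_le_of_norm_le (((integrable_const _).add hd).const_mul _)
        (ae_of_all _ fun x => k.abs_apply_le f x)
    · rw [quadrature_apply, Finset.sum_mul]
      refine (norm_sum_le _ _).trans (Finset.sum_le_sum fun i _ => ?_)
      rw [norm_mul, mul_assoc]
      refine mul_le_mul_of_nonneg_left ?_ (norm_nonneg _)
      rw [mul_comm]
      exact k.abs_apply_le f _
  refine ⟨(InnerProductSpace.toDual ℝ k.Space).symm (E.mkContinuous _ hb), fun f => ?_⟩
  rw [InnerProductSpace.toDual_symm_apply]
  rfl

/-- R is the norm of the representer r of the error functional: the supremum is attained at r/‖r‖,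
and R² is the error functional applied to r, whose values are known from the kernel sections. -/
theorem exists_sqError_eq [MeasurableSpace X] (k : RKernel X)
    (hk : ∀ y, Measurable fun x => k x y) (μ : Measure X) [IsFiniteMeasure μ]
    (hd : Integrable (fun x => k x x) μ) {n : ℕ} (a : Fin n → ℝ) (t : Fin n → X) :
    ∃ R : ℝ, 0 ≤ R ∧ k.sqError μ (quadrature a t) = R ^ 2 ∧
      k.worstCaseError μ a t = ENNReal.ofReal R := by
  obtain ⟨r, hr⟩ := k.exists_representer hk μ hd a t
  have hval : ∀ y, r y = ∫ x, k x y ∂μ - quadrature a t fun x => k x y := fun y => by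
    rw [← inner_kernelSection, hr]
    simp only [kernelSection_apply]
    congr 2
    funext x
    exact k.kernelSection_apply x y
  refine ⟨‖r‖, norm_nonneg _, ?_, le_antisymm ?_ ?_⟩
  · rw [← real_inner_self_eq_norm_sq, hr]
    have hrI := k.integrable_coe hk μ hd r
    have hI : ∀ x, Integrable (fun y => k x y) μ := fun x => by
      simpa only [k.symm] using k.integrable_section hk μ hd x
    have hL : Integrable (fun y => quadrature a t fun x => k x y) μ := by
      simp only [quadrature_apply]
      exact integrable_finsetSum _ fun i _ => (hI _).const_mul _
    -- Only separate measurability of k is assumed, so Fubini is not available: the mean is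
    -- integrable because it is r plus a finite combination of sections.
    have hq : Integrable (fun y => ∫ x, k x y ∂μ) μ := by
      refine (hrI.add hL).congr (ae_of_all _ fun y => ?_)
      simp [hval]
    have hr' : (r : X → ℝ) = (fun y => ∫ x, k x y ∂μ) - fun y => quadrature a t fun x => k x y :=
      funext hval
    have hsw : ∫ y, (quadrature a t fun x => k x y) ∂μ
        = quadrature a t (fun y => ∫ x, k x y ∂μ) := by
      simp only [quadrature_apply]
      rw [integral_finsetSum _ fun i _ => (hI _).const_mul _]
      refine Finset.sum_congr rfl fun i _ => ?_
      rw [integral_const_mul]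
      simp only [k.symm (t i)]
    rw [hr', map_sub]
    simp only [Pi.sub_apply]
    rw [integral_sub hq hL, hsw, sqError]
    ring
  · refine iSup₂_le fun f hf => ENNReal.ofReal_le_ofReal ?_
    have h1 := hr f
    rw [quadrature_apply] at h1
    rw [← h1]
    refine (abs_real_inner_le_norm _ _).trans ?_
    nlinarith [norm_nonneg r]
  · by_cases h0 : ‖r‖ = 0
    · simp [h0]
    refine le_iSup₂_of_le (‖r‖⁻¹ • r) ?_ (ENNReal.ofReal_le_ofReal ?_)
    · rw [norm_smul, norm_inv, norm_norm, inv_mul_cancel₀ h0]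
    · have h1 := hr (‖r‖⁻¹ • r)
      rw [quadrature_apply] at h1
      rw [← h1, inner_smul_right, real_inner_self_eq_norm_sq]
      refine le_abs_self _ |>.trans' (le_of_eq ?_)
      field_simp

theorem worstCaseError_le_iff [MeasurableSpace X] (k : RKernel X)
    (hk : ∀ y, Measurable fun x => k x y) (μ : Measure X) [IsFiniteMeasure μ]
    (hd : Integrable (fun x => k x x) μ) {n : ℕ} (a : Fin n → ℝ) (t : Fin n → X)
    {c : ℝ} (hc : 0 ≤ c) :
    k.worstCaseError μ a t ≤ ENNReal.ofReal c ↔ k.sqError μ (quadrature a t) ≤ c ^ 2 := by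
  obtain ⟨R, hR, h1, h2⟩ := k.exists_sqError_eq hk μ hd a t
  rw [h1, h2, ENNReal.ofReal_le_ofReal_iff hc, sq_le_sq₀ hR hc]

end RKernel

/-! ### Integrals of product functions and the errors over H_u -/

theorem integral_infinitePi_prod {X : ℕ → Type*} [∀ j, MeasurableSpace (X j)]
    (μ : ∀ j, Measure (X j)) [∀ j, IsProbabilityMeasure (μ j)] (u : Finset ℕ)
    (f : ∀ j, X j → ℝ) (hf : ∀ j, Measurable (f j)) :
    ∫ x, ∏ j ∈ u, f j (x j) ∂(Measure.infinitePi μ) = ∏ j ∈ u, ∫ x, f j x ∂(μ j) := by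
  have hm : Measurable fun y : (∀ i : u, X i) => ∏ i : u, f i (y i) :=
    Finset.measurable_prod _ fun i _ => (hf i).comp (measurable_pi_apply i)
  have h := integral_map (μ := Measure.infinitePi μ)
    (Finset.measurable_restrict u).aemeasurable hm.aestronglyMeasurable
  rw [Measure.infinitePi_map_restrict,
    integral_fintype_prod_eq_prod (𝕜 := ℝ) (fun i : u => f i)] at h
  rw [Finset.prod_coe_sort u fun j => ∫ x, f j x ∂(μ j)] at h
  rw [h]
  refine integral_congr_ae (ae_of_all _ fun x => ?_)
  exact (Finset.prod_coe_sort u fun j => f j (x j)).symm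

theorem integrable_infinitePi_prod {X : ℕ → Type*} [∀ j, MeasurableSpace (X j)]
    (μ : ∀ j, Measure (X j)) [∀ j, IsProbabilityMeasure (μ j)] (u : Finset ℕ)
    (f : ∀ j, X j → ℝ) (hf : ∀ j, Measurable (f j)) (hi : ∀ j, Integrable (f j) (μ j)) :
    Integrable (fun x => ∏ j ∈ u, f j (x j)) (Measure.infinitePi μ) := by
  have hm : Measurable fun y : (∀ i : u, X i) => ∏ i : u, f i (y i) :=
    Finset.measurable_prod _ fun i _ => (hf i).comp (measurable_pi_apply i)
  have h := integrable_map_measure (μ := Measure.infinitePi μ) (f := u.restrict)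
    hm.aestronglyMeasurable (Finset.measurable_restrict u).aemeasurable
  rw [Measure.infinitePi_map_restrict] at h
  have h2 := h.mp (Integrable.fintype_prod_dep (f := fun i : u => f i) fun i => hi i)
  refine h2.congr (ae_of_all _ fun x => ?_)
  exact Finset.prod_coe_sort u fun j => f j (x j)

namespace AnchoredKernel

variable {D : Set ℝ}

theorem measurable_left (K : AnchoredKernel D) (y : D) : Measurable fun x => K.toFun x y :=
  K.measurable.comp (measurable_id.prodMk measurable_const)

theorem measurable_diag (K : AnchoredKernel D) : Measurable fun x => K.toFun x x :=
  K.measurable.comp (measurable_id.prodMk measurable_id)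

/-- The representer of integration, `h(y) = ∫ K(x, y) ρ(dx)`. -/
noncomputable def mean (K : AnchoredKernel D) (ρ : Measure D) (y : D) : ℝ := ∫ x, K.toFun x y ∂ρ

theorem measurable_mean (K : AnchoredKernel D) (ρ : Measure D) [SFinite ρ] :
    Measurable (K.mean ρ) :=
  (K.measurable.stronglyMeasurable.integral_prod_left' (μ := ρ)).measurable

theorem two_abs_mean_le (K : AnchoredKernel D) (ρ : Measure D) [IsProbabilityMeasure ρ]
    (hM : Integrable (fun x => K.toFun x x) ρ) (y : D) :
    2 * |K.mean ρ y| ≤ K.diagIntegral ρ + K.toFun y y :=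
  K.toRKernel.two_abs_integral_le K.measurable_left ρ hM y

theorem integrable_mean (K : AnchoredKernel D) (ρ : Measure D) [IsProbabilityMeasure ρ]
    (hM : Integrable (fun x => K.toFun x x) ρ) : Integrable (K.mean ρ) ρ := by
  refine ((integrable_const (K.diagIntegral ρ)).add hM).mono'
    (K.measurable_mean ρ).aestronglyMeasurable (ae_of_all _ fun y => ?_)
  have := K.two_abs_mean_le ρ hM y
  rw [Real.norm_eq_abs]
  simp only [Pi.add_apply]
  linarith [abs_nonneg (K.mean ρ y)]

/-- Makes ∑ γ_u C₀^|u| finite, and with it the error of the zero algorithm. -/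
theorem doubleIntegral_le (K : AnchoredKernel D) (ρ : Measure D) [IsProbabilityMeasure ρ]
    (hM : Integrable (fun x => K.toFun x x) ρ) : K.doubleIntegral ρ ≤ K.diagIntegral ρ := by
  have h := integral_mono ((K.integrable_mean ρ hM).const_mul 2)
    ((integrable_const (K.diagIntegral ρ)).add hM) fun y =>
      (mul_le_mul_of_nonneg_left (le_abs_self _) zero_le_two).trans (K.two_abs_mean_le ρ hM y)
  simp only [Pi.add_apply] at h
  rw [integral_const_mul, integral_add (integrable_const _) hM, integral_const] at h
  simp only [probReal_univ, one_smul] at h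
  change 2 * K.doubleIntegral ρ ≤ _ + K.diagIntegral ρ at h
  linarith

/-- The squared worst case error of the functional `L` over `H_u`, for integration with respect to
a product of copies of `ρ`. -/
noncomputable def coordSqError {ι : Type*} (K : AnchoredKernel D) (ρ : Measure D) (u : Finset ι)
    (L : ((ι → D) → ℝ) →ₗ[ℝ] ℝ) : ℝ :=
  K.doubleIntegral ρ ^ u.card - 2 * L (fun y => ∏ j ∈ u, K.mean ρ (y j)) +
    L fun y => L fun x => K.toRKernel.tensor u x y

/-- The kernel over `u` sees only coordinates in `u`, so the error on D^u is given by a formula in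
the full points. This formula makes coordinate sets inside different index types comparable. -/
theorem errorOn_le_iff {ι : Type*} (K : AnchoredKernel D) (ρ : Measure D)
    [IsProbabilityMeasure ρ] (hM : Integrable (fun x => K.toFun x x) ρ) (u : Finset ι) {n : ℕ}
    (a : Fin n → ℝ) (t : Fin n → ι → D) {c : ℝ} (hc : 0 ≤ c) :
    K.errorOn ρ u a t ≤ ENNReal.ofReal c ↔ K.coordSqError ρ u (quadrature a t) ≤ c ^ 2 := by
  rw [errorOn, RKernel.worstCaseError_le_iff _ _ _ _ _ _ hc]
  · suffices h : (K.toRKernel.tensor (Finset.univ : Finset u)).sqError (Measure.pi fun _ => ρ)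
        (quadrature a fun i j => t i j) = K.coordSqError ρ u (quadrature a t) by rw [h]
    have hmean : ∀ y : u → D, ∫ x, K.toRKernel.tensor (Finset.univ : Finset u) x y
        ∂(Measure.pi fun _ => ρ) = ∏ j : u, K.mean ρ (y j) := fun y =>
      integral_fintype_prod_eq_prod (𝕜 := ℝ) (fun (i : u) x => K.toFun x (y i))
    have hdbl : ∫ y : u → D, ∏ j : u, K.mean ρ (y j) ∂(Measure.pi fun _ => ρ) =
        K.doubleIntegral ρ ^ u.card := by
      rw [integral_fintype_prod_eq_prod (𝕜 := ℝ) (fun (_ : u) x => K.mean ρ x)]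
      simp [doubleIntegral, mean]
    simp only [RKernel.sqError, hmean, coordSqError, hdbl]
    simp only [quadrature_apply, RKernel.tensor_apply]
    congr 1
    · congr 2
      refine Finset.sum_congr rfl fun i _ => ?_
      rw [Finset.prod_coe_sort u fun j => K.mean ρ (t i j)]
    · refine Finset.sum_congr rfl fun i _ => ?_
      congr 1
      refine Finset.sum_congr rfl fun l _ => ?_
      rw [Finset.prod_coe_sort u fun j => K.toFun (t l j) (t i j)]
  · intro y
    simp only [RKernel.tensor_apply]
    exact Finset.measurable_prod _ fun i _ => (K.measurable_left _).comp (measurable_pi_apply i)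
  · exact Integrable.fintype_prod (f := fun (_ : u) x => K.toFun x x) fun _ => hM

/-- Relabelling the coordinates in `u` does not change the error over `H_u`. -/
theorem coordSqError_comp {ι ι' κ : Type*} [DecidableEq ι'] [Fintype κ] (K : AnchoredKernel D)
    (ρ : Measure D) {u : Finset ι} {φ : ι → ι'} (hφ : Set.InjOn φ u) (a : κ → ℝ)
    (t : κ → ι' → D) :
    K.coordSqError ρ u (quadrature a fun i => t i ∘ φ) =
      K.coordSqError ρ (u.image φ) (quadrature a t) := by
  simp only [coordSqError, quadrature_apply, RKernel.tensor_apply, Finset.card_image_of_injOn hφ,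
    Finset.prod_image hφ, Function.comp_apply]

end AnchoredKernel

/-! ### Integration over the domain and expansion of the error over coordinate sets -/

theorem integral_subtype_comap_of_ae_mem {X : Type*} [MeasurableSpace X] {μ : Measure X}
    {s : Set X} (hs : MeasurableSet s) (hae : ∀ᵐ x ∂μ, x ∈ s) (f : X → ℝ) :
    ∫ x : s, f x ∂(μ.comap Subtype.val) = ∫ x, f x ∂μ := by
  rw [integral_subtype_comap hs, Measure.restrict_eq_self_of_ae_mem hae]

theorem integrable_subtype_comap {X : Type*} [MeasurableSpace X] {μ : Measure X}
    {s : Set X} (hs : MeasurableSet s) {f : X → ℝ} (hf : Integrable f μ) :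
    Integrable (fun x : s => f x) (μ.comap Subtype.val) := by
  have h : Integrable f ((μ.comap (Subtype.val : s → X)).map Subtype.val) := by
    rw [map_comap_subtype_coe hs]
    exact hf.restrict
  exact (MeasurableEmbedding.subtype_coe hs).integrable_map_iff.mp h

namespace AnchoredKernel

variable {D : Set ℝ}

theorem measurable_tensor_left (K : AnchoredKernel D) (u : Finset ℕ) (y : ℕ → D) :
    Measurable fun x => K.toRKernel.tensor u x y := by
  simp only [RKernel.tensor_apply]
  exact Finset.measurable_prod _ fun i _ => (K.measurable_left _).comp (measurable_pi_apply i)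

theorem measurable_tensor_diag (K : AnchoredKernel D) (u : Finset ℕ) :
    Measurable fun x => K.toRKernel.tensor u x x := by
  simp only [RKernel.tensor_apply]
  exact Finset.measurable_prod _ fun i _ => K.measurable_diag.comp (measurable_pi_apply i)

section Integrals

variable (K : AnchoredKernel D) (ρ : Measure D) [IsProbabilityMeasure ρ]
  (hM : Integrable (fun x => K.toFun x x) ρ)

theorem integral_tensor_left (u : Finset ℕ) (y : ℕ → D) :
    ∫ x, K.toRKernel.tensor u x y ∂(Measure.infinitePi fun _ => ρ) = ∏ j ∈ u, K.mean ρ (y j) :=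
  integral_infinitePi_prod (fun _ => ρ) u (fun j x => K.toFun x (y j))
    fun _ => K.measurable_left _

theorem integral_tensor_diag (u : Finset ℕ) :
    ∫ x, K.toRKernel.tensor u x x ∂(Measure.infinitePi fun _ => ρ) =
      K.diagIntegral ρ ^ u.card := by
  have h := integral_infinitePi_prod (fun _ => ρ) u (fun _ x => K.toFun x x)
    fun _ => K.measurable_diag
  rw [Finset.prod_const] at h
  exact h

theorem integral_prod_mean (u : Finset ℕ) :
    ∫ y, ∏ j ∈ u, K.mean ρ (y j) ∂(Measure.infinitePi fun _ => ρ) =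
      K.doubleIntegral ρ ^ u.card := by
  have h := integral_infinitePi_prod (fun _ => ρ) u (fun _ x => K.mean ρ x)
    fun _ => K.measurable_mean ρ
  rw [Finset.prod_const] at h
  exact h

include hM

theorem integrable_tensor_diag (u : Finset ℕ) :
    Integrable (fun x => K.toRKernel.tensor u x x) (Measure.infinitePi fun _ : ℕ => ρ) :=
  integrable_infinitePi_prod (fun _ => ρ) u (fun _ x => K.toFun x x)
    (fun _ => K.measurable_diag) fun _ => hM

theorem integrable_tensor_left (u : Finset ℕ) (y : ℕ → D) :
    Integrable (fun x => K.toRKernel.tensor u x y) (Measure.infinitePi fun _ : ℕ => ρ) :=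
  (K.toRKernel.tensor u).integrable_section (K.measurable_tensor_left u) _
    (K.integrable_tensor_diag ρ hM u) y

theorem integrable_prod_mean (u : Finset ℕ) :
    Integrable (fun y => ∏ j ∈ u, K.mean ρ (y j)) (Measure.infinitePi fun _ : ℕ => ρ) :=
  integrable_infinitePi_prod (fun _ => ρ) u (fun _ x => K.mean ρ x)
    (fun _ => K.measurable_mean ρ) fun _ => K.integrable_mean ρ hM

theorem two_mul_integral_abs_tensor_le (u : Finset ℕ) (y : ℕ → D) :
    2 * ∫ x, |K.toRKernel.tensor u x y| ∂(Measure.infinitePi fun _ => ρ) ≤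
      K.diagIntegral ρ ^ u.card + K.toRKernel.tensor u y y := by
  rw [← K.integral_tensor_diag ρ u]
  exact (K.toRKernel.tensor u).two_mul_integral_abs_le (K.measurable_tensor_left u) _
    (K.integrable_tensor_diag ρ hM u) y

theorem integral_abs_prod_mean_le (u : Finset ℕ) :
    ∫ y, |∏ j ∈ u, K.mean ρ (y j)| ∂(Measure.infinitePi fun _ => ρ) ≤
      K.diagIntegral ρ ^ u.card := by
  have hi := K.integrable_tensor_diag ρ hM u
  have h := integral_mono ((K.integrable_prod_mean ρ hM u).abs.const_mul 2)
    (hi.add (integrable_const (K.diagIntegral ρ ^ u.card))) fun y => by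
      have h2 := (K.toRKernel.tensor u).two_abs_integral_le (K.measurable_tensor_left u) _
        (K.integrable_tensor_diag ρ hM u) y
      rw [K.integral_tensor_left, K.integral_tensor_diag] at h2
      rw [Pi.add_apply, add_comm]
      exact h2
  simp only [Pi.add_apply] at h
  rw [integral_const_mul, integral_add hi (integrable_const _), integral_const,
    K.integral_tensor_diag] at h
  simp only [probReal_univ, one_smul] at h
  linarith

variable (γ : Finset ℕ → ℝ≥0) (hγ : Summable fun u => (γ u : ℝ) * K.diagIntegral ρ ^ u.card)

omit hM [IsProbabilityMeasure ρ] in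
theorem weighted_diag_nonneg (x : ℕ → D) (u : Finset ℕ) :
    0 ≤ (γ u : ℝ) * K.toRKernel.tensor u x x :=
  mul_nonneg (γ u).coe_nonneg (RKernel.diag_nonneg _ x)

omit hM [IsProbabilityMeasure ρ] in
theorem mem_domain_iff (x : ℕ → D) :
    x ∈ K.domain γ ↔ ∑' u, ENNReal.ofReal ((γ u : ℝ) * K.toRKernel.tensor u x x) ≠ ∞ := by
  refine ⟨fun h => Summable.tsum_ofReal_ne_top h, fun h => ?_⟩
  refine (ENNReal.summable_toReal h).congr fun u => ?_
  exact ENNReal.toReal_ofReal (K.weighted_diag_nonneg γ x u)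

omit hM [IsProbabilityMeasure ρ] in
theorem measurable_tsum_diag :
    Measurable fun x => ∑' u, ENNReal.ofReal ((γ u : ℝ) * K.toRKernel.tensor u x x) :=
  Measurable.tsum fun u => ((K.measurable_tensor_diag u).const_mul _).ennreal_ofReal

omit hM [IsProbabilityMeasure ρ] in
theorem measurableSet_domain : MeasurableSet (K.domain γ) := by
  have : K.domain γ = (fun x => ∑' u, ENNReal.ofReal ((γ u : ℝ) *
      K.toRKernel.tensor u x x)) ⁻¹' {∞}ᶜ := by
    ext x
    exact K.mem_domain_iff γ x
  rw [this]
  exact K.measurable_tsum_diag γ (measurableSet_singleton _).compl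

include hγ

/-- By Tonelli the integral is ∑ γ_u M^|u|. Consequently the domain has full measure and the
diagonal of the weighted kernel is integrable. -/
theorem lintegral_tsum_diag_ne_top :
    ∫⁻ x, ∑' u, ENNReal.ofReal ((γ u : ℝ) * K.toRKernel.tensor u x x)
      ∂(Measure.infinitePi fun _ : ℕ => ρ) ≠ ∞ := by
  rw [lintegral_tsum fun u =>
    ((K.measurable_tensor_diag u).const_mul _).ennreal_ofReal.aemeasurable]
  convert! hγ.tsum_ofReal_ne_top using 3 with u
  rw [← ofReal_integral_eq_lintegral_ofReal ((K.integrable_tensor_diag ρ hM u).const_mul _)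
    (ae_of_all _ fun x => K.weighted_diag_nonneg γ x u), integral_const_mul,
    K.integral_tensor_diag]

theorem ae_mem_domain : ∀ᵐ x ∂(Measure.infinitePi fun _ : ℕ => ρ), x ∈ K.domain γ := by
  filter_upwards [ae_lt_top (K.measurable_tsum_diag γ) (K.lintegral_tsum_diag_ne_top ρ hM γ hγ)]
    with x hx
  exact (K.mem_domain_iff γ x).mpr hx.ne

theorem integrable_weighted_diag :
    Integrable (fun x => K.weighted γ x x)
      ((Measure.infinitePi fun _ : ℕ => ρ).comap Subtype.val) := by
  refine (integrable_subtype_comap (K.measurableSet_domain γ)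
    (integrable_toReal_of_lintegral_ne_top (K.measurable_tsum_diag γ).aemeasurable
      (K.lintegral_tsum_diag_ne_top ρ hM γ hγ))).congr (ae_of_all _ fun x => ?_)
  have hx : Summable fun u => (γ u : ℝ) * K.toRKernel.tensor u (x : ℕ → D) x := x.2
  change (∑' u, ENNReal.ofReal ((γ u : ℝ) * K.toRKernel.tensor u (x : ℕ → D) x)).toReal =
    ∑' u, (γ u : ℝ) * K.toRKernel.tensor u (x : ℕ → D) x
  rw [← ENNReal.ofReal_tsum_of_nonneg (K.weighted_diag_nonneg γ x) hx,
    ENNReal.toReal_ofReal (tsum_nonneg (K.weighted_diag_nonneg γ x))]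

omit hM hγ [IsProbabilityMeasure ρ] in
theorem hasSum_weighted (x y : K.domain γ) :
    HasSum (fun u => (γ u : ℝ) * K.toRKernel.tensor u (x : ℕ → D) y) (K.weighted γ x y) :=
  (K.summable_of_mem_domain γ x y).hasSum

omit hM hγ [IsProbabilityMeasure ρ] in
theorem measurable_weighted_left (y : K.domain γ) : Measurable fun x => K.weighted γ x y := by
  refine measurable_of_tendsto_metrizable' (f := fun (s : Finset (Finset ℕ)) (x : K.domain γ) =>
    ∑ u ∈ s, (γ u : ℝ) * K.toRKernel.tensor u (x : ℕ → D) y) atTop (fun s => ?_) ?_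
  · exact Finset.measurable_sum _ fun u _ =>
      ((K.measurable_tensor_left u _).comp measurable_subtype_coe).const_mul _
  · exact tendsto_pi_nhds.mpr fun x => K.hasSum_weighted γ x y

theorem hasSum_weighted_mean (y : K.domain γ) :
    HasSum (fun u => (γ u : ℝ) * ∏ j ∈ u, K.mean ρ ((y : ℕ → D) j))
      (∫ x, K.weighted γ x y ∂((Measure.infinitePi fun _ : ℕ => ρ).comap Subtype.val)) := by
  have hI := integral_subtype_comap_of_ae_mem (K.measurableSet_domain γ)
    (K.ae_mem_domain ρ hM γ hγ)
  have h := hasSum_integral_of_summable_integral_norm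
    (μ := (Measure.infinitePi fun _ : ℕ => ρ).comap Subtype.val)
    (F := fun u (x : K.domain γ) => (γ u : ℝ) * K.toRKernel.tensor u (x : ℕ → D) y)
    (fun u => integrable_subtype_comap (K.measurableSet_domain γ)
      ((K.integrable_tensor_left ρ hM u y).const_mul _)) ?_
  · convert! h using 1
    refine funext fun u => Eq.symm ?_
    rw [hI fun x => (γ u : ℝ) * K.toRKernel.tensor u x y, integral_const_mul,
      K.integral_tensor_left]
  -- Domination for the termwise integration: the u-th term is at most γ_u M^|u| + γ_u K_u(y, y).
  · refine Summable.of_nonneg_of_le (fun u => integral_nonneg fun x => norm_nonneg _)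
      (fun u => ?_) (hγ.add y.2)
    rw [hI fun x => ‖(γ u : ℝ) * K.toRKernel.tensor u x y‖]
    simp only [norm_mul, Real.norm_eq_abs, NNReal.abs_eq]
    rw [integral_const_mul, ← mul_add]
    refine mul_le_mul_of_nonneg_left ?_ (γ u).coe_nonneg
    have h1 := K.two_mul_integral_abs_tensor_le ρ hM u y
    have h2 : 0 ≤ ∫ x, |K.toRKernel.tensor u x (y : ℕ → D)| ∂(Measure.infinitePi fun _ => ρ) :=
      integral_nonneg fun x => abs_nonneg _
    linarith

theorem hasSum_weighted_double :
    HasSum (fun u => (γ u : ℝ) * K.doubleIntegral ρ ^ u.card)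
      (∫ y, ∫ x, K.weighted γ x y ∂((Measure.infinitePi fun _ : ℕ => ρ).comap Subtype.val)
        ∂((Measure.infinitePi fun _ : ℕ => ρ).comap Subtype.val)) := by
  have hI := integral_subtype_comap_of_ae_mem (K.measurableSet_domain γ)
    (K.ae_mem_domain ρ hM γ hγ)
  have h := hasSum_integral_of_summable_integral_norm
    (μ := (Measure.infinitePi fun _ : ℕ => ρ).comap Subtype.val)
    (F := fun u (y : K.domain γ) => (γ u : ℝ) * ∏ j ∈ u, K.mean ρ ((y : ℕ → D) j))
    (fun u => integrable_subtype_comap (K.measurableSet_domain γ)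
      ((K.integrable_prod_mean ρ hM u).const_mul _)) ?_
  · simp only [fun y => (K.hasSum_weighted_mean ρ hM γ hγ y).tsum_eq] at h
    convert! h using 1
    refine funext fun u => Eq.symm ?_
    rw [hI fun y => (γ u : ℝ) * ∏ j ∈ u, K.mean ρ (y j), integral_const_mul,
      K.integral_prod_mean]
  · refine Summable.of_nonneg_of_le (fun u => integral_nonneg fun x => norm_nonneg _)
      (fun u => ?_) hγ
    rw [hI fun y => ‖(γ u : ℝ) * ∏ j ∈ u, K.mean ρ (y j)‖]
    simp only [norm_mul, Real.norm_eq_abs, NNReal.abs_eq]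
    rw [integral_const_mul]
    exact mul_le_mul_of_nonneg_left (K.integral_abs_prod_mean_le ρ hM u) (γ u).coe_nonneg

end Integrals

end AnchoredKernel

namespace Algorithm

variable {D : Set ℝ}

/-- The linear functional on functions on `D^ℕ` that an algorithm computes. -/
noncomputable def functional {c : D} (Q : Algorithm c) : ((ℕ → D) → ℝ) →ₗ[ℝ] ℝ :=
  quadrature Q.a Q.point

/-- The squared worst case error is the weighted sum of the squared errors over the `H_u`. -/
theorem error_le_of_tsum_le (K : AnchoredKernel D) (ρ : Measure D) [IsProbabilityMeasure ρ]
    (hM : Integrable (fun x => K.toFun x x) ρ) (γ : Finset ℕ → ℝ≥0)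
    (hγ : Summable fun u => (γ u : ℝ) * K.diagIntegral ρ ^ u.card) (Q : Algorithm K.anchor)
    {c : ℝ} (hc : 0 ≤ c) {g : Finset ℕ → ℝ} (hg : Summable g) (hgc : ∑' u, g u ≤ c ^ 2)
    (hQg : ∀ u, (γ u : ℝ) * K.coordSqError ρ u Q.functional ≤ g u) :
    Q.error K ρ γ ≤ ENNReal.ofReal c := by
  have hfin : IsFiniteMeasure ((Measure.infinitePi fun _ : ℕ => ρ).comap
      (Subtype.val : K.domain γ → ℕ → D)) := by
    refine ⟨?_⟩
    rw [(MeasurableEmbedding.subtype_coe (K.measurableSet_domain γ)).comap_apply]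
    exact measure_lt_top _ _
  rw [error, RKernel.worstCaseError_le_iff _ (K.measurable_weighted_left γ) _
    (K.integrable_weighted_diag ρ hM γ hγ) _ _ hc]
  refine le_trans ?_ hgc
  have hp : ∀ i, Q.point i ∈ K.domain γ := fun i =>
    K.mem_domain_of_finite γ (Q.v i) (Q.point i) fun _ hj => dif_neg hj
  -- The three terms of the squared error, each expanded as a series over `u`; their combination is
  -- the series of γ_u times the error over H_u.
  have h1 := K.hasSum_weighted_double ρ hM γ hγ
  have h2 := (hasSum_sum (s := Finset.univ) fun i _ =>
    (K.hasSum_weighted_mean ρ hM γ hγ ⟨_, hp i⟩).mul_left (Q.a i)).mul_left 2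
  have h3 := hasSum_sum (s := Finset.univ) fun i _ => (hasSum_sum (s := Finset.univ) fun l _ =>
    (K.hasSum_weighted γ ⟨_, hp l⟩ ⟨_, hp i⟩).mul_left (Q.a l)).mul_left (Q.a i)
  refine hasSum_le (fun u => ?_) ((h1.sub h2).add h3) hg.hasSum
  refine le_trans (le_of_eq ?_) (hQg u)
  simp only [AnchoredKernel.coordSqError, functional, quadrature_apply, mul_add, mul_sub,
    Finset.mul_sum]
  congr 1
  · congr 1
    exact Finset.sum_congr rfl fun i _ => by ring
  · exact Finset.sum_congr rfl fun i _ => Finset.sum_congr rfl fun l _ => by ring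

end Algorithm

/-! ### Algorithms built from anchored quadratures -/

/-- An alternating sum over the sets between `v` and `u`. -/
theorem sum_powerset_ite_subset_sdiff {ι : Type*} [DecidableEq ι] (u v : Finset ι) :
    ∑ z ∈ u.powerset, (if v ⊆ u \ z then (-1 : ℝ) ^ z.card else 0) = if v = u then 1 else 0 := by
  rw [← Finset.sum_filter]
  by_cases hvu : v ⊆ u
  · have hf : u.powerset.filter (fun z => v ⊆ u \ z) = (u \ v).powerset := by
      ext z
      simp only [Finset.mem_filter, Finset.mem_powerset, Finset.subset_sdiff]
      exact ⟨fun h => ⟨h.1, h.2.2.symm⟩, fun h => ⟨h.1, hvu, h.2.symm⟩⟩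
    have h := congrArg (Int.cast : ℤ → ℝ) (Finset.sum_powerset_neg_one_pow_card (x := u \ v))
    push_cast at h
    rw [hf, h]
    have : u \ v = ∅ ↔ v = u := by
      rw [Finset.sdiff_eq_empty_iff_subset]
      exact ⟨fun h => hvu.antisymm h, fun h => h ▸ subset_rfl⟩
    simp only [this]
  · rw [if_neg fun h => hvu h.subset, Finset.sum_filter]
    exact Finset.sum_eq_zero fun z _ => if_neg fun h => hvu (h.trans Finset.sdiff_subset)

namespace Algorithm

variable {D : Set ℝ} {c : D}

/-- Replace the coordinates of `x` outside `w` by `c`. -/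
noncomputable def anchorOutside (c : D) (w : Finset ℕ) (x : ℕ → D) : ℕ → D :=
  fun j => if j ∈ w then x j else c

/-- A coordinate of `u` outside `w` contributes the factor f_j(c) = 0. This is what makes anchored
sampling separate the coordinate sets. -/
theorem prod_anchorOutside (w u : Finset ℕ) (x : ℕ → D) (f : ℕ → D → ℝ) (hf : ∀ j, f j c = 0) :
    ∏ j ∈ u, f j (anchorOutside c w x j) = if u ⊆ w then ∏ j ∈ u, f j (x j) else 0 := by
  split_ifs with h
  · exact Finset.prod_congr rfl fun j hj => by rw [anchorOutside, if_pos (h hj)]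
  · obtain ⟨j, hj, hjw⟩ := Finset.not_subset.mp h
    exact Finset.prod_eq_zero hj (by rw [anchorOutside, if_neg hjw, hf])

theorem exists_functional_eq {κ : Type*} [Fintype κ] (a : κ → ℝ) (x : κ → ℕ → D)
    (w : κ → Finset ℕ) :
    ∃ Q : Algorithm c, Q.functional = quadrature a (fun i => anchorOutside c (w i) (x i)) ∧
      ∀ price : ℕ → ℝ, Monotone price → Q.cost price ≤ ∑ i, price (w i).card := by
  classical
  let e := (Fintype.equivFin κ).symm
  let Q : Algorithm c :=
    { n := Fintype.card κ
      -- Algorithms may not sample the value c on v, so coordinates equal to c are dropped; the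
      -- point is unchanged and a monotone price does not increase.
      v := fun i => (w (e i)).filter fun j => x (e i) j ≠ c
      t := fun i j => x (e i) j
      t_ne := fun i j => (Finset.mem_filter.mp j.2).2
      a := fun i => a (e i) }
  have hpt : ∀ i, Q.point i = anchorOutside c (w (e i)) (x (e i)) := fun i => by
    funext j
    simp only [point, anchorOutside, Q, Finset.mem_filter]
    split_ifs with h1 h2 h2
    · rfl
    · exact absurd h1.1 h2
    · exact (not_not.mp fun h => h1 ⟨h2, h⟩).symm
    · rfl
  refine ⟨Q, LinearMap.ext fun g => ?_, fun price hp => ?_⟩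
  · simp only [functional, quadrature_apply, hpt]
    exact e.sum_comp fun i => a i * g (anchorOutside c (w i) (x i))
  · refine le_trans ?_ (e.sum_comp fun i => price (w i).card).le
    exact Finset.sum_le_sum fun i _ => hp (Finset.card_filter_le _ _)

/-- A combination of quadratures, each with its points anchored outside some finite set. -/
theorem exists_combination {β : Type*} (s : Finset β) (σ : β → ℝ) (w : β → Finset ℕ) (N : β → ℕ)
    (a : ∀ n : ℕ, Fin n → ℝ) (x : ∀ n : ℕ, Fin n → ℕ → D) :
    ∃ Q : Algorithm c,
      (∀ (u : Finset ℕ) (f : ℕ → D → ℝ), (∀ j, f j c = 0) →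
        Q.functional (fun y => ∏ j ∈ u, f j (y j)) = ∑ b ∈ s,
          (if u ⊆ w b then σ b else 0) *
            quadrature (a (N b)) (x (N b)) (fun y => ∏ j ∈ u, f j (y j))) ∧
      ∀ price : ℕ → ℝ, Monotone price → Q.cost price ≤ ∑ b ∈ s, N b * price (w b).card := by
  obtain ⟨Q, hQ, hc⟩ := exists_functional_eq (c := c)
    (κ := Σ b : s, Fin (N b)) (fun i => σ i.1 * a (N i.1) i.2) (fun i => x (N i.1) i.2)
    (fun i => w i.1)
  refine ⟨Q, fun u f hf => ?_, fun price hp => (hc price hp).trans (le_of_eq ?_)⟩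
  · rw [hQ, quadrature_apply, Fintype.sum_sigma, ← Finset.sum_coe_sort s]
    refine Finset.sum_congr rfl fun b _ => ?_
    rw [quadrature_apply, Finset.mul_sum]
    refine Finset.sum_congr rfl fun i _ => ?_
    rw [prod_anchorOutside _ _ _ _ hf]
    split_ifs
    · ring
    · ring
  · rw [Fintype.sum_sigma, ← Finset.sum_coe_sort s]
    simp

/-- A telescoping algorithm: the points of its `k`-th level live on `v k`. -/
theorem exists_telescoping (a : ∀ n : ℕ, Fin n → ℝ) (x : ∀ n : ℕ, Fin n → ℕ → D)
    (N : ℕ → ℕ) {v : ℕ → Finset ℕ} (hv : Monotone v) (m : ℕ) :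
    ∃ Q : Algorithm c,
      (∀ u, (∀ k ≤ m, ¬ u ⊆ v k) → ∀ f : ℕ → D → ℝ, (∀ j, f j c = 0) →
        Q.functional (fun y => ∏ j ∈ u, f j (y j)) = 0) ∧
      (∀ u, ∀ k ≤ m, u ⊆ v k → ∃ l ≤ k, ∀ f : ℕ → D → ℝ, (∀ j, f j c = 0) →
        Q.functional (fun y => ∏ j ∈ u, f j (y j)) =
          quadrature (a (N l)) (x (N l)) (fun y => ∏ j ∈ u, f j (y j))) ∧
      ∀ price : ℕ → ℝ, Monotone price → (∀ k, 0 ≤ price k) →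
        Q.cost price ≤ 2 * ∑ k ∈ Finset.range (m + 1), N k * price (v k).card := by
  classical
  -- Level k is the quadrature with N k points on v k minus the same one on v (k - 1). At k = 0 the
  -- subtraction truncates, and the coefficient 0 removes the term.
  obtain ⟨Q, hQ, hc⟩ := exists_combination (c := c) (Finset.range (m + 1) ×ˢ Finset.univ)
    (fun b : ℕ × Bool => if b.2 then (if b.1 = 0 then 0 else -1) else 1)
    (fun b => if b.2 then v (b.1 - 1) else v b.1) (fun b => N b.1) a x
  simp only [Finset.sum_product, Fintype.sum_bool, if_true, Bool.false_eq_true, if_false,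
    ← add_mul] at hQ hc
  refine ⟨Q, fun u hu f hf => ?_, fun u k hk huk => ?_, fun price hp hp0 => ?_⟩
  · rw [hQ u f hf]
    refine Finset.sum_eq_zero fun k hk => ?_
    have hkm : k ≤ m := Nat.lt_succ_iff.mp (Finset.mem_range.mp hk)
    rw [if_neg (hu k hkm), if_neg (hu (k - 1) (by omega))]
    simp
  -- Take the first level l whose v l contains `u`. Earlier levels do not see `u`, and on later ones
  -- the two terms cancel.
  · have hex : ∃ l, u ⊆ v l := ⟨k, huk⟩
    have hiff : ∀ i, u ⊆ v i ↔ Nat.find hex ≤ i := fun i =>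
      ⟨fun h => Nat.find_min' hex h, fun h => (Nat.find_spec hex).trans (hv h)⟩
    have hlk : Nat.find hex ≤ k := (hiff k).mp huk
    refine ⟨Nat.find hex, hlk, fun f hf => ?_⟩
    rw [hQ u f hf, Finset.sum_eq_single (Nat.find hex)]
    · rw [if_pos ((hiff _).mpr le_rfl)]
      by_cases h0 : Nat.find hex = 0
      · simp [h0]
      · rw [if_neg fun h => by have := (hiff _).mp h; omega]
        simp
    · intro i _ hi
      rcases lt_or_gt_of_ne hi with h | h
      · rw [if_neg fun h' => by have := (hiff _).mp h'; omega,
          if_neg fun h' => by have := (hiff _).mp h'; omega]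
        simp
      · rw [if_pos ((hiff _).mpr (by omega)), if_pos ((hiff _).mpr (by omega)),
          if_neg (by omega)]
        simp
    · intro h
      exact absurd (Finset.mem_range.mpr (by omega)) h
  · refine (hc price hp).trans ?_
    rw [Finset.mul_sum]
    refine Finset.sum_le_sum fun k _ => ?_
    have := hp (Finset.card_le_card (hv (Nat.sub_le k 1)))
    have := mul_le_mul_of_nonneg_left this (Nat.cast_nonneg (α := ℝ) (N k))
    linarith

/-- An algorithm that treats the sets in `S` separately, by means of the anchored decomposition. -/
theorem exists_decomposition (a : ∀ n : ℕ, Fin n → ℝ) (x : ∀ n : ℕ, Fin n → ℕ → D)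
    (S : Finset (Finset ℕ)) (N : Finset ℕ → ℕ) :
    ∃ Q : Algorithm c,
      (∀ u ∉ S, ∀ f : ℕ → D → ℝ, (∀ j, f j c = 0) →
        Q.functional (fun y => ∏ j ∈ u, f j (y j)) = 0) ∧
      (∀ u ∈ S, ∀ f : ℕ → D → ℝ, (∀ j, f j c = 0) →
        Q.functional (fun y => ∏ j ∈ u, f j (y j)) =
          quadrature (a (N u)) (x (N u)) (fun y => ∏ j ∈ u, f j (y j))) ∧
      ∀ price : ℕ → ℝ, Monotone price →
        Q.cost price ≤ ∑ u ∈ S, 2 ^ u.card * (N u * price u.card) := by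
  -- Inclusion-exclusion over the anchored sets u \ z isolates the component of exactly `u`; the
  -- 2^|u| terms account for the factor in the cost.
  obtain ⟨Q, hQ, hc⟩ := exists_combination (c := c) (S.sigma fun u => u.powerset)
    (fun b : Σ _ : Finset ℕ, Finset ℕ => (-1 : ℝ) ^ b.2.card) (fun b => b.1 \ b.2)
    (fun b => N b.1) a x
  simp only [Finset.sum_sigma] at hc
  have hQ' : ∀ (u : Finset ℕ) (f : ℕ → D → ℝ), (∀ j, f j c = 0) →
      Q.functional (fun y => ∏ j ∈ u, f j (y j)) = ∑ v ∈ S, (if u = v then 1 else 0) *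
        quadrature (a (N v)) (x (N v)) (fun y => ∏ j ∈ u, f j (y j)) := fun u f hf => by
    refine ((hQ u f hf).trans (Finset.sum_sigma _ _ _)).trans (Finset.sum_congr rfl fun v _ => ?_)
    rw [← sum_powerset_ite_subset_sdiff, Finset.sum_mul]
  refine ⟨Q, fun u hu f hf => ?_, fun u hu f hf => ?_, fun price hp => (hc price hp).trans ?_⟩
  · rw [hQ' u f hf]
    refine Finset.sum_eq_zero fun v hv => ?_
    rw [if_neg fun h : u = v => hu (h ▸ hv), zero_mul]
  · rw [hQ' u f hf, Finset.sum_eq_single u]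
    · rw [if_pos rfl, one_mul]
    · intro v _ hv
      rw [if_neg hv.symm, zero_mul]
    · exact fun h => absurd hu h
  · refine Finset.sum_le_sum fun u _ => ?_
    refine (Finset.sum_le_card_nsmul _ _ (N u * price u.card) fun z _ => ?_).trans (le_of_eq ?_)
    · exact mul_le_mul_of_nonneg_left (hp (Finset.card_le_card Finset.sdiff_subset))
        (Nat.cast_nonneg _)
    · rw [Finset.card_powerset, nsmul_eq_mul]
      push_cast
      rfl

end Algorithm

/-! ### Action of an algorithm on a single H_u -/

namespace AnchoredKernel

variable {D : Set ℝ}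

theorem apply_anchor (K : AnchoredKernel D) (x : D) : K.toFun x K.anchor = 0 :=
  K.toRKernel.eq_zero_of_diag K.anchored

/-- The error over `H_u` only depends on the values of the functional at product functions that
vanish if some coordinate in `u` equals the anchor. -/
theorem coordSqError_congr {κ : Type*} [Fintype κ] (K : AnchoredKernel D) (ρ : Measure D)
    (u : Finset ℕ) (L : ((ℕ → D) → ℝ) →ₗ[ℝ] ℝ) (a : κ → ℝ) (x : κ → ℕ → D)
    (h : ∀ f : ℕ → D → ℝ, (∀ j, f j K.anchor = 0) →
      L (fun y => ∏ j ∈ u, f j (y j)) = quadrature a x (fun y => ∏ j ∈ u, f j (y j))) :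
    K.coordSqError ρ u L = K.coordSqError ρ u (quadrature a x) := by
  have h1 := h (fun _ => K.mean ρ) fun _ => by
    have : ∀ x, K.toFun x K.anchor = 0 := K.apply_anchor
    simp [mean, this]
  have h2 : ∀ y : ℕ → D, L (fun x => K.toRKernel.tensor u x y) =
      quadrature a x (fun x => K.toRKernel.tensor u x y) := fun y =>
    h (fun j x => K.toFun x (y j)) fun j => by rw [K.toRKernel.symm]; exact K.apply_anchor _
  have h3 : ∀ y : ℕ → D, L (fun x => K.toRKernel.tensor u y x) =
      quadrature a x (fun x => K.toRKernel.tensor u y x) := fun y =>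
    h (fun j x => K.toFun (y j) x) fun j => K.apply_anchor _
  -- With the inner functional already a quadrature, the outer argument is a finite combination of
  -- product functions, to which the hypothesis applies again.
  have h4 : L (fun y => quadrature a x fun x => K.toRKernel.tensor u x y) =
      quadrature a x fun y => quadrature a x fun x => K.toRKernel.tensor u x y := by
    have : (fun y => quadrature a x fun x => K.toRKernel.tensor u x y) =
        ∑ i, a i • fun y => K.toRKernel.tensor u (x i) y := by
      funext y
      simp [quadrature_apply, Finset.sum_apply]
    rw [this, map_sum, map_sum]
    exact Finset.sum_congr rfl fun i _ => by rw [map_smul, map_smul, h3]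
  simp only [coordSqError, h1, h2, h4]

theorem coordSqError_of_eq_zero (K : AnchoredKernel D) (ρ : Measure D)
    (u : Finset ℕ) (L : ((ℕ → D) → ℝ) →ₗ[ℝ] ℝ)
    (h : ∀ f : ℕ → D → ℝ, (∀ j, f j K.anchor = 0) → L (fun y => ∏ j ∈ u, f j (y j)) = 0) :
    K.coordSqError ρ u L = K.doubleIntegral ρ ^ u.card := by
  rw [K.coordSqError_congr ρ u L (κ := Fin 0) Fin.elim0 Fin.elim0 fun f hf => by
    rw [h f hf, quadrature_apply, Fin.sum_univ_zero]]
  simp [coordSqError, quadrature_apply]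

end AnchoredKernel

/-! ### Multilevel algorithms and their cost -/

theorem finite_setOf_lt {A : Set (Finset ℕ)} {J : Finset ℕ → ℕ} (hJ : Set.InjOn J A) (n : ℕ) :
    {u | u ∈ A ∧ J u < n}.Finite :=
  Set.Finite.of_finite_image ((Set.finite_Iio n).subset (by rintro _ ⟨u, hu, rfl⟩; exact hu.2))
    (hJ.mono fun _ hu => hu.1)

/-- The sets in `A` whose index is less than `n`. -/
noncomputable def initialSets {A : Set (Finset ℕ)} {J : Finset ℕ → ℕ} (hJ : Set.InjOn J A)
    (n : ℕ) : Finset (Finset ℕ) := (finite_setOf_lt hJ n).toFinset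

theorem mem_initialSets {A : Set (Finset ℕ)} {J : Finset ℕ → ℕ} (hJ : Set.InjOn J A) {n : ℕ}
    {u : Finset ℕ} : u ∈ initialSets hJ n ↔ u ∈ A ∧ J u < n := by
  simp [initialSets]

theorem card_initialSets_le {A : Set (Finset ℕ)} {J : Finset ℕ → ℕ} (hJ : Set.InjOn J A)
    (n : ℕ) : (initialSets hJ n).card ≤ n := by
  have h := Finset.card_le_card_of_injOn (s := initialSets hJ n) (t := Finset.range n) J
    (fun u hu => Finset.mem_coe.mpr (Finset.mem_range.mpr ((mem_initialSets hJ).mp hu).2))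
    (hJ.mono fun u hu => ((mem_initialSets hJ).mp hu).1)
  simpa using h

theorem two_pow_log_le {n : ℕ} (hn : 1 ≤ n) : 2 ^ Nat.log 2 n ≤ n :=
  Nat.pow_log_le_self 2 (by omega)

theorem log_le_of_lt {n m : ℕ} (hn : 1 ≤ n) (h : n < 2 ^ (m + 1)) : Nat.log 2 n ≤ m :=
  Nat.lt_succ_iff.mp (Nat.log_lt_of_lt_pow (by omega) h)

namespace AnchoredKernel

variable {D : Set ℝ} (K : AnchoredKernel D) (ρ : Measure D) (a : ∀ n : ℕ, Fin n → ℝ)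
  (x : ∀ n : ℕ, Fin n → ℕ → D)

/-- On each `H_u` with `u ∈ A`, the algorithm `Q` acts as one of the quadratures with `N l` points,
`l ≤ m`, or as the zero algorithm if the index of `u` is at least `2^(m+1)`. -/
def IsMultilevel (A : Set (Finset ℕ)) (J : Finset ℕ → ℕ) (N : ℕ → ℕ) (m : ℕ)
    (Q : Algorithm K.anchor) : Prop :=
  ∀ u ∈ A, (∃ l ≤ m, 2 ^ l ≤ J u ∧ K.coordSqError ρ u Q.functional =
      K.coordSqError ρ u (quadrature (a (N l)) (x (N l)))) ∨
    (2 ^ (m + 1) ≤ J u ∧ K.coordSqError ρ u Q.functional = K.doubleIntegral ρ ^ u.card)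

variable {A : Set (Finset ℕ)} {J : Finset ℕ → ℕ} (hJ : Set.InjOn J A) (hJ1 : ∀ u ∈ A, 1 ≤ J u)
  {d : ℕ} (hd : ∀ u ∈ A, u.card ≤ d) {price : ℕ → ℝ} (hone : ∀ k, 1 ≤ price k)
  (hmono : Monotone price)

include hJ hJ1 hd hone hmono

/-- The k-th coordinate set is the union of all active sets of index below 2^(k+1), each of size at
most d, hence has at most 2^(k+1) d elements. This is the cheaper construction for s ≤ 1. -/
theorem exists_isMultilevel_telescoping {s C : ℝ} (hs : 0 ≤ s)
    (hC : ∀ k : ℕ, price k ≤ C * ((k : ℝ) + 1) ^ s) (N : ℕ → ℕ) (m : ℕ) :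
    ∃ Q : Algorithm K.anchor, K.IsMultilevel ρ a x A J N m Q ∧ Q.cost price ≤
      2 * (C * (2 * (d : ℝ) + 1) ^ s) *
        ∑ k ∈ Finset.range (m + 1), N k * ((2 : ℝ) ^ k) ^ s := by
  classical
  let v : ℕ → Finset ℕ := fun k => (initialSets hJ (2 ^ (k + 1))).biUnion id
  have hv : Monotone v := fun k l hkl => by
    refine Finset.biUnion_subset_biUnion_of_subset_left _ fun u hu => ?_
    rw [mem_initialSets] at hu ⊢
    exact ⟨hu.1, hu.2.trans_le (Nat.pow_le_pow_right two_pos (by omega))⟩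
  have hcard : ∀ k, (v k).card ≤ 2 ^ (k + 1) * d := fun k => by
    refine (Finset.card_biUnion_le_card_mul _ _ d fun u hu => ?_).trans ?_
    · exact hd u ((mem_initialSets hJ).mp hu).1
    · exact Nat.mul_le_mul_right d (card_initialSets_le hJ _)
  have hC0 : 0 ≤ C := by
    have h := (zero_le_one.trans (hone 0)).trans (hC 0)
    simpa using h
  obtain ⟨Q, hQ0, hQ1, hQc⟩ := Algorithm.exists_telescoping (c := K.anchor) a x N hv m
  refine ⟨Q, fun u hu => ?_, (hQc price hmono fun k => zero_le_one.trans (hone k)).trans ?_⟩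
  · rcases lt_or_ge (J u) (2 ^ (m + 1)) with h | h
    · have hsub : u ⊆ v (Nat.log 2 (J u)) := Finset.subset_biUnion_of_mem id
        ((mem_initialSets hJ).mpr ⟨hu, Nat.lt_pow_succ_log_self one_lt_two _⟩)
      have hlog := log_le_of_lt (hJ1 u hu) h
      obtain ⟨l, hl, hQl⟩ := hQ1 u _ hlog hsub
      exact Or.inl ⟨l, hl.trans hlog, (Nat.pow_le_pow_right two_pos hl).trans
        (two_pow_log_le (hJ1 u hu)), K.coordSqError_congr ρ u _ _ _ hQl⟩
    -- A set of large index may still be covered by the coordinates of a level; it is then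
    -- integrated there, and 2^l ≤ J u holds all the more.
    · by_cases hex : ∃ k ≤ m, u ⊆ v k
      · obtain ⟨k, hk, huk⟩ := hex
        obtain ⟨l, hl, hQl⟩ := hQ1 u k hk huk
        exact Or.inl ⟨l, hl.trans hk, (Nat.pow_le_pow_right two_pos (by omega)).trans h,
          K.coordSqError_congr ρ u _ _ _ hQl⟩
      · exact Or.inr ⟨h, K.coordSqError_of_eq_zero ρ u _
          (hQ0 u fun k hk huk => hex ⟨k, hk, huk⟩)⟩
  · rw [mul_assoc]
    refine mul_le_mul_of_nonneg_left ?_ zero_le_two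
    rw [Finset.mul_sum]
    refine Finset.sum_le_sum fun k _ => ?_
    rw [mul_left_comm]
    refine mul_le_mul_of_nonneg_left ?_ (Nat.cast_nonneg _)
    refine (hC _).trans ?_
    rw [mul_assoc, ← Real.mul_rpow (by positivity) (by positivity)]
    refine mul_le_mul_of_nonneg_left (Real.rpow_le_rpow (by positivity) ?_ hs) hC0
    have h1 : ((v k).card : ℝ) ≤ 2 ^ (k + 1) * d := by exact_mod_cast hcard k
    have h2 : (1 : ℝ) ≤ 2 ^ k := one_le_pow₀ one_le_two
    rw [pow_succ] at h1
    linarith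

/-- Each active set has its own quadrature at price at most 2^d $(d) per point, and fewer than
2^(k+1) sets share level k; s plays no role. -/
theorem exists_isMultilevel_decomposition (N : ℕ → ℕ) (m : ℕ) :
    ∃ Q : Algorithm K.anchor, K.IsMultilevel ρ a x A J N m Q ∧ Q.cost price ≤
      2 * (2 ^ d * price d) * ∑ k ∈ Finset.range (m + 1), N k * ((2 : ℝ) ^ k) ^ (1 : ℝ) := by
  classical
  obtain ⟨Q, hQ0, hQ1, hQc⟩ := Algorithm.exists_decomposition (c := K.anchor) a x
    (initialSets hJ (2 ^ (m + 1))) (fun u => N (Nat.log 2 (J u)))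
  refine ⟨Q, fun u hu => ?_, (hQc price hmono).trans ?_⟩
  · rcases lt_or_ge (J u) (2 ^ (m + 1)) with h | h
    · exact Or.inl ⟨_, log_le_of_lt (hJ1 u hu) h, two_pow_log_le (hJ1 u hu),
        K.coordSqError_congr ρ u _ _ _ (hQ1 u ((mem_initialSets hJ).mpr ⟨hu, h⟩))⟩
    · exact Or.inr ⟨h, K.coordSqError_of_eq_zero ρ u _
        (hQ0 u fun hmem => absurd ((mem_initialSets hJ).mp hmem).2 (by omega))⟩
  · have hp : ∀ k, 0 ≤ price k := fun k => zero_le_one.trans (hone k)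
    have h1 : ∑ u ∈ initialSets hJ (2 ^ (m + 1)),
        2 ^ u.card * ((N (Nat.log 2 (J u)) : ℝ) * price u.card) ≤
        ∑ u ∈ initialSets hJ (2 ^ (m + 1)), (2 ^ d * price d) * (N (Nat.log 2 (J u)) : ℝ) := by
      refine Finset.sum_le_sum fun u hu => ?_
      have hud := hd u ((mem_initialSets hJ).mp hu).1
      have h2 : (2 : ℝ) ^ u.card * price u.card ≤ 2 ^ d * price d :=
        mul_le_mul (pow_le_pow_right₀ one_le_two hud) (hmono hud) (hp _) (by positivity)
      have := mul_le_mul_of_nonneg_right h2 (Nat.cast_nonneg (α := ℝ) (N (Nat.log 2 (J u))))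
      linarith
    refine h1.trans ?_
    rw [← Finset.mul_sum, mul_comm 2, mul_assoc _ (2 : ℝ)]
    refine mul_le_mul_of_nonneg_left ?_ (mul_nonneg (pow_nonneg zero_le_two d) (hp d))
    rw [← Finset.sum_fiberwise_of_maps_to (t := Finset.range (m + 1))
      (g := fun u => Nat.log 2 (J u)), Finset.mul_sum]
    · refine Finset.sum_le_sum fun k _ => ?_
      have hsum : ∑ u ∈ (initialSets hJ (2 ^ (m + 1))).filter (fun u => Nat.log 2 (J u) = k),
          (N (Nat.log 2 (J u)) : ℝ) =
          ((initialSets hJ (2 ^ (m + 1))).filter fun u => Nat.log 2 (J u) = k).card * (N k : ℝ) := by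
        rw [← nsmul_eq_mul, ← Finset.sum_const]
        exact Finset.sum_congr rfl fun u hu => by rw [(Finset.mem_filter.mp hu).2]
      have hcard : ((initialSets hJ (2 ^ (m + 1))).filter fun u => Nat.log 2 (J u) = k).card ≤
          2 ^ (k + 1) := by
        refine (Finset.card_le_card fun u hu => ?_).trans (card_initialSets_le hJ (2 ^ (k + 1)))
        rw [Finset.mem_filter, mem_initialSets] at hu
        rw [mem_initialSets]
        exact ⟨hu.1.1, hu.2 ▸ Nat.lt_pow_succ_log_self one_lt_two _⟩
      have hcard' : (((initialSets hJ (2 ^ (m + 1))).filter fun u => Nat.log 2 (J u) = k).card : ℝ)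
          ≤ 2 ^ (k + 1) := by exact_mod_cast hcard
      rw [hsum, Real.rpow_one]
      refine (mul_le_mul_of_nonneg_right hcard' (Nat.cast_nonneg _)).trans (le_of_eq ?_)
      rw [pow_succ]
      ring
    · intro u hu
      rw [mem_initialSets] at hu
      exact Finset.mem_range.mpr (Nat.lt_succ_of_le (log_le_of_lt (hJ1 u hu.1) hu.2))

theorem exists_isMultilevel {s C : ℝ} (hs : 0 ≤ s)
    (hC : ∀ k : ℕ, price k ≤ C * ((k : ℝ) + 1) ^ s) :
    ∃ C' : ℝ, 0 ≤ C' ∧ ∀ (N : ℕ → ℕ) (m : ℕ),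
      ∃ Q : Algorithm K.anchor, K.IsMultilevel ρ a x A J N m Q ∧ Q.cost price ≤
        C' * ∑ k ∈ Finset.range (m + 1), N k * ((2 : ℝ) ^ k) ^ (min 1 s) := by
  rcases le_total 1 s with h | h
  · rw [min_eq_left h]
    refine ⟨2 * (2 ^ d * price d), ?_, fun N m =>
      K.exists_isMultilevel_decomposition ρ a x hJ hJ1 hd hone hmono N m⟩
    have := zero_le_one.trans (hone d)
    positivity
  · rw [min_eq_right h]
    refine ⟨2 * (C * (2 * (d : ℝ) + 1) ^ s), ?_, fun N m =>
      K.exists_isMultilevel_telescoping ρ a x hJ hJ1 hd hone hmono hs hC N m⟩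
    have hC0 : 0 ≤ C := by
      have h := (zero_le_one.trans (hone 0)).trans (hC 0)
      simpa using h
    positivity

end AnchoredKernel

/-! ### From geometric error decay to a complexity bound -/

/-- If the errors decrease geometrically and the costs grow like the power `-q` of the errors,
then the complexity is of order `ε ^ (-q)`. -/
theorem complexity_le_of_geometric {D : Set ℝ} (K : AnchoredKernel D) (ρ : Measure D)
    (γ : Finset ℕ → ℝ≥0) (price : ℕ → ℝ) {q E₀ E C y : ℝ} (hq : 0 < q) (hC : 0 ≤ C) (hy : 1 < y)
    (h₀ : ∃ Q : Algorithm K.anchor, Q.error K ρ γ ≤ ENNReal.ofReal E₀ ∧ Q.cost price = 0)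
    (h : ∀ m : ℕ, ∃ Q : Algorithm K.anchor, Q.error K ρ γ ≤ ENNReal.ofReal (E / y ^ m) ∧
      Q.cost price ≤ C * (y ^ m) ^ q) :
    ∃ A : ℝ, 0 ≤ A ∧ ∀ ε : ℝ, 0 < ε →
      complexity K ρ γ price ε ≤ ENNReal.ofReal (A * ε ^ (-q)) := by
  let E' := max (max E E₀) 1
  have hE' : 0 < E' := zero_lt_one.trans_le (le_max_right _ _)
  have hy0 : 0 < y := zero_lt_one.trans hy
  refine ⟨C * (y * E') ^ q, by positivity, fun ε hε => ?_⟩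
  -- The bound must hold for large ε too, where ε ^ (-q) tends to 0: there the zero algorithm is
  -- used.
  rcases le_or_gt E' ε with hle | hlt
  · obtain ⟨Q, hQ, hc⟩ := h₀
    refine iInf₂_le_of_le Q (hQ.trans (ENNReal.ofReal_le_ofReal ?_)) ?_
    · exact ((le_max_right _ _).trans (le_max_left _ _)).trans hle
    · rw [hc, ENNReal.ofReal_zero]
      exact zero_le
  · obtain ⟨n, hn1, hn2⟩ := exists_nat_pow_near ((one_le_div hε).mpr hlt.le) hy
    obtain ⟨Q, hQ, hc⟩ := h (n + 1)
    refine iInf₂_le_of_le Q (hQ.trans (ENNReal.ofReal_le_ofReal ?_))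
      (ENNReal.ofReal_le_ofReal (hc.trans ?_))
    · rw [div_le_iff₀ (by positivity)]
      rw [div_lt_iff₀ hε] at hn2
      have : E ≤ E' := (le_max_left _ _).trans (le_max_left _ _)
      linarith [mul_comm (y ^ (n + 1)) ε]
    · rw [mul_assoc]
      refine mul_le_mul_of_nonneg_left ?_ hC
      rw [Real.rpow_neg hε.le, ← div_eq_mul_inv, ← Real.div_rpow (by positivity) hε.le]
      refine Real.rpow_le_rpow (by positivity) ?_ hq.le
      rw [pow_succ, mul_comm, mul_div_assoc]
      exact mul_le_mul_of_nonneg_left hn1 hy0.le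

/-- The geometric sums that bound the cost of a multilevel algorithm. -/
theorem sum_ceil_rpow_mul_le {κ σ θ : ℝ} (hκ : 0 ≤ κ) (hκθ : κ < θ) (hσθ : σ < θ) :
    ∃ C : ℝ, 0 ≤ C ∧ ∀ m : ℕ, ∑ k ∈ Finset.range (m + 1),
      (⌈(2 : ℝ) ^ (κ * ((m : ℝ) - k))⌉₊ : ℝ) * ((2 : ℝ) ^ k) ^ σ ≤ C * ((2 : ℝ) ^ θ) ^ m := by
  set η := max κ σ with hη
  have hηθ : 0 < θ - η := sub_pos.mpr (max_lt hκθ hσθ)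
  set δ := (θ - η) * Real.log 2 with hδ
  have hδ0 : 0 < δ := mul_pos hηθ (Real.log_pos one_lt_two)
  refine ⟨2 * (1 + 1 / δ), by positivity, fun m => ?_⟩
  -- The exponent κ(m - k) + σk is at most max(κ, σ) m; the factor 2 pays for rounding up.
  have hterm : ∀ k ∈ Finset.range (m + 1),
      (⌈(2 : ℝ) ^ (κ * ((m : ℝ) - k))⌉₊ : ℝ) * ((2 : ℝ) ^ k) ^ σ ≤ 2 * (2 : ℝ) ^ (η * m) := by
    intro k hk
    have hkm : (k : ℝ) ≤ m := by
      exact_mod_cast Nat.lt_succ_iff.mp (Finset.mem_range.mp hk)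
    have h1 : (1 : ℝ) ≤ 2 ^ (κ * ((m : ℝ) - k)) :=
      Real.one_le_rpow one_le_two (mul_nonneg hκ (sub_nonneg.mpr hkm))
    have h2 := Nat.ceil_lt_add_one (zero_le_one.trans h1)
    have h3 : ((2 : ℝ) ^ k) ^ σ = 2 ^ (σ * k) := by
      rw [← Real.rpow_natCast, ← Real.rpow_mul zero_le_two, mul_comm]
    rw [h3]
    calc (⌈(2 : ℝ) ^ (κ * ((m : ℝ) - k))⌉₊ : ℝ) * 2 ^ (σ * k)
        ≤ 2 * 2 ^ (κ * ((m : ℝ) - k)) * 2 ^ (σ * k) :=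
          mul_le_mul_of_nonneg_right (by linarith) (by positivity)
      _ = 2 * 2 ^ (κ * ((m : ℝ) - k) + σ * k) := by rw [mul_assoc, ← Real.rpow_add two_pos]
      _ ≤ 2 * 2 ^ (η * m) := by
          refine mul_le_mul_of_nonneg_left (Real.rpow_le_rpow_of_exponent_le one_le_two ?_)
            zero_le_two
          have h4 := mul_le_mul_of_nonneg_right (le_max_left κ σ) (sub_nonneg.mpr hkm)
          have h5 := mul_le_mul_of_nonneg_right (le_max_right κ σ) (Nat.cast_nonneg (α := ℝ) k)
          rw [← hη] at h4 h5
          linarith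
  refine (Finset.sum_le_card_nsmul _ _ _ hterm).trans ?_
  rw [Finset.card_range, nsmul_eq_mul]
  -- The number m + 1 of terms is absorbed by the gap between max(κ, σ) and θ.
  have h6 : ((m + 1 : ℕ) : ℝ) ≤ (1 + 1 / δ) * 2 ^ ((θ - η) * m) := by
    have h7 : (2 : ℝ) ^ ((θ - η) * m) = Real.exp (δ * m) := by
      rw [Real.rpow_def_of_pos two_pos, hδ]
      ring_nf
    have h8 := Real.add_one_le_exp (δ * m)
    rw [h7]
    have h9 : (1 + 1 / δ) * (δ * m + 1) ≤ (1 + 1 / δ) * Real.exp (δ * m) :=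
      mul_le_mul_of_nonneg_left h8 (by positivity)
    refine le_trans ?_ h9
    have h10 : (1 + 1 / δ) * (δ * m + 1) = m + 1 + (δ * m + 1 / δ) := by
      field_simp
      ring
    rw [h10]
    push_cast
    have : 0 ≤ δ * m + 1 / δ := by positivity
    linarith
  calc ((m + 1 : ℕ) : ℝ) * (2 * 2 ^ (η * m))
      ≤ (1 + 1 / δ) * 2 ^ ((θ - η) * m) * (2 * 2 ^ (η * m)) :=
        mul_le_mul_of_nonneg_right h6 (by positivity)
    _ = 2 * (1 + 1 / δ) * (2 ^ ((θ - η) * m) * 2 ^ (η * m)) := by ring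
    _ = 2 * (1 + 1 / δ) * (2 ^ θ) ^ m := by
        rw [← Real.rpow_add two_pos, ← Real.rpow_natCast (2 ^ θ), ← Real.rpow_mul zero_le_two]
        ring_nf

/-- Splits the decay in two: the power p - r is kept for summability over all sets, the power r
yields the gain at level l. -/
theorem rpow_neg_le_of_two_pow_le {j l : ℕ} {p r : ℝ} (hr : 0 ≤ r) (h : 2 ^ l ≤ j) :
    (j : ℝ) ^ (-p) ≤ (j : ℝ) ^ (-(p - r)) * 2 ^ (-(r * l)) := by
  have hj : (2 : ℝ) ^ l ≤ j := by exact_mod_cast h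
  have hj0 : (0 : ℝ) < j := lt_of_lt_of_le (by positivity) hj
  have h1 : (j : ℝ) ^ (-p) = (j : ℝ) ^ (-(p - r)) * (j : ℝ) ^ (-r) := by
    rw [← Real.rpow_add hj0]
    ring_nf
  rw [h1]
  refine mul_le_mul_of_nonneg_left ?_ (by positivity)
  have h2 : (2 : ℝ) ^ (-(r * l)) = ((2 : ℝ) ^ l) ^ (-r) := by
    rw [← Real.rpow_natCast, ← Real.rpow_mul zero_le_two]
    ring_nf
  rw [h2]
  exact Real.rpow_le_rpow_of_nonpos (by positivity) hj (neg_nonpos.mpr hr)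

namespace AnchoredKernel

variable {D : Set ℝ}

/-- The complexity bound for weights with polynomial decay along an enumeration `J`. -/
theorem exists_complexity_le (K : AnchoredKernel D) (ρ : Measure D) [IsProbabilityMeasure ρ]
    (hM : Integrable (fun x => K.toFun x x) ρ) (hC₀ : 0 ≤ K.doubleIntegral ρ)
    (γ : Finset ℕ → ℝ≥0) (hγ : Summable fun u => (γ u : ℝ) * K.diagIntegral ρ ^ u.card)
    {J : Finset ℕ → ℕ} (hJ : Set.InjOn J {u | 0 < γ u}) (hJ1 : ∀ u, 0 < γ u → 1 ≤ J u)
    {d : ℕ} (hd : ∀ u, 0 < γ u → u.card ≤ d) {p G : ℝ}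
    (hG : ∀ u, 0 < γ u → (γ u : ℝ) ≤ G * (J u : ℝ) ^ (-p))
    (hG' : ∀ u, 0 < γ u → (γ u : ℝ) * K.doubleIntegral ρ ^ u.card ≤ G * (J u : ℝ) ^ (-p))
    {price : ℕ → ℝ} (hone : ∀ k, 1 ≤ price k) (hmono : Monotone price)
    {s C : ℝ} (hs : 0 ≤ s) (hC : ∀ k : ℕ, price k ≤ C * ((k : ℝ) + 1) ^ s)
    (a : ∀ n : ℕ, Fin n → ℝ) (x : ∀ n : ℕ, Fin n → ℕ → D) {α c : ℝ} (hα : 0 < α)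
    (hQ : ∀ n : ℕ, 1 ≤ n → ∀ u, 0 < γ u →
      K.coordSqError ρ u (quadrature (a n) (x n)) ≤ (c * (n : ℝ) ^ (-α)) ^ 2)
    {q : ℝ} (hqα : 1 / α < q) (hqs : 2 * min 1 s / q + 1 < p) :
    ∃ A : ℝ, 0 ≤ A ∧ ∀ ε : ℝ, 0 < ε →
      complexity K ρ γ price ε ≤ ENNReal.ofReal (A * ε ^ (-q)) := by
  have hq : 0 < q := lt_trans (by positivity) hqα
  have hs' : 0 ≤ min 1 s := le_min zero_le_one hs
  -- r < p - 1 keeps the sum over J convergent; r > 2 min(1, s)/q keeps the cost of the high levels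
  -- within 2^(rqm/2).
  obtain ⟨r, hr1, hr2⟩ := exists_between (lt_sub_iff_add_lt.mpr hqs)
  have hr : 0 < r := lt_of_le_of_lt (by positivity) hr1
  -- Chosen so that N_l^(-2α) ≤ 2^(-r(m-l)), which with the gain 2^(-rl) gives 2^(-rm) at every
  -- level.
  set κ := r / (2 * α) with hκ
  have hκ0 : 0 < κ := by positivity
  have hκq : κ < r / 2 * q := by
    have h := mul_lt_mul_of_pos_left hqα (half_pos hr)
    refine lt_of_eq_of_lt ?_ h
    rw [hκ]
    field_simp
  have hsq : min 1 s < r / 2 * q := by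
    rw [div_lt_iff₀ hq] at hr1
    linarith
  obtain ⟨C₁, hC₁, hcost⟩ := sum_ceil_rpow_mul_le hκ0.le hκq hsq
  obtain ⟨C₂, hC₂, hmulti⟩ := K.exists_isMultilevel ρ a x hJ hJ1 hd hone hmono hs hC
  have hactive : ∀ u, ¬ 0 < γ u → (γ u : ℝ) = 0 := fun u hu => by
    have : γ u = 0 := by simpa using hu
    simp [this]
  set S : Finset ℕ → ℝ := Set.indicator {u | 0 < γ u} fun u => (J u : ℝ) ^ (-(p - r)) with hS
  have hSsum : Summable S := by
    rw [hS, ← summable_subtype_iff_indicator]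
    have h := Real.summable_nat_rpow.mpr (show -(p - r) < -1 by linarith)
    exact h.comp_injective (i := fun u : {u | 0 < γ u} => J u) hJ.injective
  have hS0 : ∀ u, 0 ≤ S u := Set.indicator_nonneg fun u _ => by positivity
  have hT : 0 ≤ ∑' u, S u := tsum_nonneg hS0
  set G' := max G 0 with hG'def
  have hG'0 : 0 ≤ G' := le_max_right _ _
  have hJp : ∀ u, (0 : ℝ) ≤ (J u : ℝ) ^ (-p) := fun u => by positivity
  have hGG : ∀ u, G * (J u : ℝ) ^ (-p) ≤ G' * (J u : ℝ) ^ (-p) := fun u =>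
    mul_le_mul_of_nonneg_right (le_max_left _ _) (hJp u)
  refine complexity_le_of_geometric K ρ γ price (y := 2 ^ (r / 2))
    -- E₀ is the error bound for the zero algorithm. In E, the factor c² + 1 covers both the
    -- integrated sets (c²) and the neglected ones (1).
    (E₀ := √(∑' u, (γ u : ℝ) * K.doubleIntegral ρ ^ u.card))
    (E := √(G' * (c ^ 2 + 1) * ∑' u, S u)) (C := C₂ * C₁) hq (by positivity)
    (Real.one_lt_rpow one_lt_two (half_pos hr)) ?_ fun m => ?_
  · have hsum : Summable fun u => (γ u : ℝ) * K.doubleIntegral ρ ^ u.card :=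
      Summable.of_nonneg_of_le (fun u => mul_nonneg (γ u).coe_nonneg (pow_nonneg hC₀ _))
        (fun u => mul_le_mul_of_nonneg_left (pow_le_pow_left₀ hC₀ (K.doubleIntegral_le ρ hM) _)
          (γ u).coe_nonneg) hγ
    refine ⟨⟨0, Fin.elim0, fun i => i.elim0, fun i => i.elim0, Fin.elim0⟩, ?_, ?_⟩
    · refine Algorithm.error_le_of_tsum_le K ρ hM γ hγ _ (Real.sqrt_nonneg _) hsum ?_ fun u => ?_
      · rw [Real.sq_sqrt (tsum_nonneg fun u => mul_nonneg (γ u).coe_nonneg (pow_nonneg hC₀ _))]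
      · rw [K.coordSqError_of_eq_zero ρ u _ fun f _ => by
          rw [Algorithm.functional, quadrature_apply]
          exact Fin.sum_univ_zero _]
    · exact Fin.sum_univ_zero _
  · obtain ⟨Q, hQm, hQc⟩ := hmulti (fun k => ⌈(2 : ℝ) ^ (κ * ((m : ℝ) - k))⌉₊) m
    refine ⟨Q, ?_, hQc.trans ?_⟩
    · refine Algorithm.error_le_of_tsum_le K ρ hM γ hγ Q (by positivity)
        (hSsum.mul_left (G' * (c ^ 2 + 1) * 2 ^ (-(r * m)))) (le_of_eq ?_) fun u => ?_
      · rw [tsum_mul_left, div_pow, Real.sq_sqrt (by positivity), ← pow_mul,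
          ← Real.rpow_natCast (2 ^ (r / 2)), ← Real.rpow_mul zero_le_two, Real.rpow_neg zero_le_two]
        have : r / 2 * ((m * 2 : ℕ) : ℝ) = r * m := by push_cast; ring
        rw [this, div_eq_mul_inv]
        ring
      by_cases hu : 0 < γ u
      swap
      · rw [hactive u hu, zero_mul]
        exact mul_nonneg (by positivity) (hS0 u)
      have hSu : S u = (J u : ℝ) ^ (-(p - r)) :=
        Set.indicator_of_mem (s := {u | 0 < γ u}) hu _
      rw [hSu]
      have hJr : (0 : ℝ) ≤ (J u : ℝ) ^ (-(p - r)) := by positivity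
      rcases hQm u hu with ⟨l, hlm, hlJ, hl⟩ | ⟨hmJ, h0⟩
      · have hpos : (0 : ℝ) < 2 ^ (κ * ((m : ℝ) - l)) := by positivity
        have hN : 1 ≤ ⌈(2 : ℝ) ^ (κ * ((m : ℝ) - l))⌉₊ := Nat.ceil_pos.mpr hpos
        have h1 : ((⌈(2 : ℝ) ^ (κ * ((m : ℝ) - l))⌉₊ : ℝ) ^ (-α)) ^ 2 ≤ 2 ^ (-(r * (m - l))) := by
          have h2 := Real.rpow_le_rpow_of_nonpos hpos
            (Nat.le_ceil ((2 : ℝ) ^ (κ * ((m : ℝ) - l)))) (neg_nonpos.mpr hα.le)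
          refine (pow_le_pow_left₀ (by positivity) h2 2).trans (le_of_eq ?_)
          rw [← Real.rpow_natCast, ← Real.rpow_mul zero_le_two, ← Real.rpow_mul zero_le_two]
          congr 1
          rw [hκ]
          push_cast
          field_simp
        have h3 := hQ _ hN u hu
        rw [hl]
        have h4 := rpow_neg_le_of_two_pow_le (p := p) hr.le hlJ
        have h5 : (2 : ℝ) ^ (-(r * m)) = 2 ^ (-(r * l)) * 2 ^ (-(r * (m - l))) := by
          rw [← Real.rpow_add two_pos]
          ring_nf
        calc (γ u : ℝ) * K.coordSqError ρ u (quadrature (a _) (x _))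
            ≤ γ u * (c ^ 2 * 2 ^ (-(r * (m - l)))) := by
              refine mul_le_mul_of_nonneg_left (h3.trans ?_) (γ u).coe_nonneg
              rw [mul_pow]
              exact mul_le_mul_of_nonneg_left h1 (sq_nonneg c)
          _ ≤ (G' * ((J u : ℝ) ^ (-(p - r)) * 2 ^ (-(r * l)))) *
                ((c ^ 2 + 1) * 2 ^ (-(r * (m - l)))) := by
              refine mul_le_mul (((hG u hu).trans (hGG u)).trans
                (mul_le_mul_of_nonneg_left h4 hG'0))
                (mul_le_mul_of_nonneg_right (by linarith) (by positivity))
                (by positivity) (by positivity)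
          _ = _ := by rw [h5]; ring
      · rw [h0]
        have h4 := rpow_neg_le_of_two_pow_le (p := p) hr.le
          ((Nat.pow_le_pow_right two_pos (Nat.le_succ m)).trans hmJ)
        calc (γ u : ℝ) * K.doubleIntegral ρ ^ u.card
            ≤ G' * ((J u : ℝ) ^ (-(p - r)) * 2 ^ (-(r * m))) :=
              ((hG' u hu).trans (hGG u)).trans (mul_le_mul_of_nonneg_left h4 hG'0)
          _ ≤ (c ^ 2 + 1) * (G' * ((J u : ℝ) ^ (-(p - r)) * 2 ^ (-(r * m)))) :=
              le_mul_of_one_le_left (by positivity) (by linarith [sq_nonneg c])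
          _ = _ := by ring
    · rw [mul_assoc]
      refine mul_le_mul_of_nonneg_left ((hcost m).trans (le_of_eq ?_)) hC₂
      simp only [← Real.rpow_natCast, ← Real.rpow_mul zero_le_two]
      ring_nf

end AnchoredKernel

/-! ### Turning the hypotheses into polynomial bounds -/

/-- Any logarithmic power is absorbed by lowering α to α'; the bound |u| ≤ d makes the constant
uniform in `u`. -/
theorem exists_log_rpow_le {b B α α' β₁ β₂ : ℝ} (hb : 0 ≤ b) (hB : 0 ≤ B) (hα' : 0 < α')
    (hα : α' < α) (hβ₁ : 0 ≤ β₁) (hβ₂ : 0 ≤ β₂) (d : ℕ) :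
    ∃ c : ℝ, 0 ≤ c ∧ ∀ n : ℕ, 1 ≤ n → ∀ i ≤ d,
      b * B ^ i * ((n : ℝ) + 1) ^ (-α) * (1 + Real.log ((n : ℝ) + 1)) ^ (β₁ * i + β₂) ≤
        c * (n : ℝ) ^ (-α') := by
  set β := β₁ * d + β₂ with hβ
  have hβ0 : 0 ≤ β := by positivity
  -- The + 1 avoids division by zero when β = 0 and still gives εβ ≤ α - α'.
  set ε := (α - α') / (β + 1) with hε
  have hε0 : 0 < ε := div_pos (sub_pos.mpr hα) (by positivity)
  have hεβ : ε * β ≤ α - α' := by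
    rw [hε, div_mul_eq_mul_div, div_le_iff₀ (by positivity)]
    nlinarith
  refine ⟨b * max B 1 ^ d * (1 + 1 / ε) ^ β, by positivity, fun n hn i hi => ?_⟩
  have hn0 : (0 : ℝ) < n := by exact_mod_cast hn
  set x := (n : ℝ) + 1 with hx
  have hx1 : 1 ≤ x := by linarith
  have hx0 : 0 < x := zero_lt_one.trans_le hx1
  have hlog : 0 ≤ Real.log x := Real.log_nonneg hx1
  have hBi : B ^ i ≤ max B 1 ^ d :=
    (pow_le_pow_left₀ hB (le_max_left _ _) i).trans (pow_le_pow_right₀ (le_max_right _ _) hi)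
  have h1 : (1 + Real.log x) ^ (β₁ * i + β₂) ≤ (1 + 1 / ε) ^ β * x ^ (α - α') := by
    have hi' : (i : ℝ) ≤ d := by exact_mod_cast hi
    calc (1 + Real.log x) ^ (β₁ * i + β₂) ≤ (1 + Real.log x) ^ β :=
          Real.rpow_le_rpow_of_exponent_le (by linarith)
            (add_le_add_left (mul_le_mul_of_nonneg_left hi' hβ₁) β₂)
      _ ≤ ((1 + 1 / ε) * x ^ ε) ^ β := by
          refine Real.rpow_le_rpow (by linarith) ?_ hβ0
          have h2 := Real.log_le_rpow_div hx0.le hε0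
          have h3 := Real.one_le_rpow hx1 hε0.le
          have h4 : (1 + 1 / ε) * x ^ ε = x ^ ε + x ^ ε / ε := by ring
          linarith
      _ = (1 + 1 / ε) ^ β * x ^ (ε * β) := by
          rw [Real.mul_rpow (by positivity) (by positivity), ← Real.rpow_mul hx0.le]
      _ ≤ (1 + 1 / ε) ^ β * x ^ (α - α') :=
          mul_le_mul_of_nonneg_left (Real.rpow_le_rpow_of_exponent_le hx1 hεβ) (by positivity)
  calc b * B ^ i * x ^ (-α) * (1 + Real.log x) ^ (β₁ * i + β₂)
      ≤ b * max B 1 ^ d * x ^ (-α) * ((1 + 1 / ε) ^ β * x ^ (α - α')) := by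
        refine mul_le_mul (mul_le_mul_of_nonneg_right (mul_le_mul_of_nonneg_left hBi hb)
          (by positivity)) h1 (by positivity) (by positivity)
    _ = b * max B 1 ^ d * (1 + 1 / ε) ^ β * (x ^ (-α) * x ^ (α - α')) := by ring
    _ = b * max B 1 ^ d * (1 + 1 / ε) ^ β * x ^ (-α') := by
        rw [← Real.rpow_add hx0]
        ring_nf
    _ ≤ _ := mul_le_mul_of_nonneg_left
        (Real.rpow_le_rpow_of_nonpos hn0 (by linarith) (by linarith)) (by positivity)

theorem exists_le_mul_rpow_of_isBigO {price : ℕ → ℝ} {s : ℝ} (hs : 0 ≤ s)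
    (h : (fun k => price k) =O[atTop] fun k : ℕ => (k : ℝ) ^ s) :
    ∃ C : ℝ, ∀ k : ℕ, price k ≤ C * ((k : ℝ) + 1) ^ s := by
  obtain ⟨C, hC⟩ := h.bound
  obtain ⟨n, hn⟩ := eventually_atTop.mp hC
  refine ⟨|C| + ∑ k ∈ Finset.range n, |price k|, fun k => ?_⟩
  have hk1 : (1 : ℝ) ≤ ((k : ℝ) + 1) ^ s :=
    Real.one_le_rpow (by linarith [k.cast_nonneg (α := ℝ)]) hs
  have hsum : 0 ≤ ∑ k ∈ Finset.range n, |price k| := Finset.sum_nonneg fun _ _ => abs_nonneg _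
  rcases lt_or_ge k n with h | h
  · have h1 := Finset.single_le_sum (f := fun k => |price k|) (fun _ _ => abs_nonneg _)
      (Finset.mem_range.mpr h)
    have h2 := le_abs_self (price k)
    calc price k ≤ |C| + ∑ k ∈ Finset.range n, |price k| := by
          linarith [abs_nonneg C]
      _ ≤ _ := le_mul_of_one_le_right (by positivity) hk1
  · have h1 := hn k h
    rw [Real.norm_eq_abs, Real.norm_eq_abs, abs_of_nonneg (by positivity : (0 : ℝ) ≤ (k : ℝ) ^ s)]
      at h1
    have h2 : (k : ℝ) ^ s ≤ ((k : ℝ) + 1) ^ s :=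
      Real.rpow_le_rpow k.cast_nonneg (by linarith) hs
    calc price k ≤ C * (k : ℝ) ^ s := (le_abs_self _).trans h1
      _ ≤ |C| * ((k : ℝ) + 1) ^ s :=
          mul_le_mul (le_abs_self C) h2 (by positivity) (abs_nonneg C)
      _ ≤ _ := mul_le_mul_of_nonneg_right (by linarith) (by positivity)

/-- An ordering whose weights decay polynomially yields an enumeration of all sets of positive
weight, the empty set included, along which the weights decay polynomially. -/
theorem IsOrdering.exists_enumeration {w : Finset ℕ → ℝ} {e : ℕ → Finset ℕ} (he : IsOrdering w e)
    {p : ℝ} (hp : 0 ≤ p)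
    (hlim : Tendsto (fun j : ℕ => orderedWeight w e j * ((j : ℝ) + 1) ^ p) atTop (𝓝 0)) :
    ∃ (J : Finset ℕ → ℕ) (G : ℝ), Set.InjOn J {u | 0 < w u} ∧ (∀ u, 1 ≤ J u) ∧ 0 ≤ G ∧
      ∀ u, 0 < w u → w u ≤ G * (J u : ℝ) ^ (-p) := by
  classical
  obtain ⟨G, hG⟩ := hlim.bddAbove_range
  have hG' : ∀ j : ℕ, orderedWeight w e j * ((j : ℝ) + 1) ^ p ≤ G := fun j => hG ⟨j, rfl⟩
  have hex : ∀ u : Finset ℕ, ∃ j, u.Nonempty → 0 < w u → e j = u := fun u => by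
    by_cases h : u.Nonempty ∧ 0 < w u
    · obtain ⟨j, hj⟩ := he.surj u h.1 h.2
      exact ⟨j, fun _ _ => hj⟩
    · exact ⟨0, fun h1 h2 => absurd ⟨h1, h2⟩ h⟩
  choose i hi using hex
  -- Index 1 is reserved for ∅, which the ordering does not list. The factor 2^p pays for the shift,
  -- as i + 2 ≤ 2(i + 1), and |w ∅| covers the empty set.
  refine ⟨fun u => if u.Nonempty then i u + 2 else 1, |G| * 2 ^ p + |w ∅|, ?_, fun u => ?_,
    by positivity, fun u hu => ?_⟩
  · intro u hu v hv huv
    simp only at huv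
    split_ifs at huv with h1 h2 h2
    · rw [← hi u h1 hu, ← hi v h2 hv, Nat.add_right_cancel huv]
    · omega
    · omega
    · rw [Finset.not_nonempty_iff_eq_empty] at h1 h2
      rw [h1, h2]
  · simp only
    split_ifs <;> omega
  · simp only
    split_ifs with h
    · have h1 := hG' (i u)
      rw [orderedWeight, hi u h hu, if_pos h] at h1
      have hpos : (0 : ℝ) < ((i u + 2 : ℕ) : ℝ) ^ p := by positivity
      have h2 : ((i u + 2 : ℕ) : ℝ) ^ p ≤ 2 ^ p * ((i u : ℝ) + 1) ^ p := by
        rw [← Real.mul_rpow zero_le_two (by positivity)]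
        refine Real.rpow_le_rpow (by positivity) ?_ hp
        push_cast
        linarith [(i u).cast_nonneg (α := ℝ)]
      rw [Real.rpow_neg (by positivity), ← div_eq_mul_inv, le_div_iff₀ hpos]
      calc w u * ((i u + 2 : ℕ) : ℝ) ^ p ≤ w u * (2 ^ p * ((i u : ℝ) + 1) ^ p) :=
            mul_le_mul_of_nonneg_left h2 hu.le
        _ = (w u * ((i u : ℝ) + 1) ^ p) * 2 ^ p := by ring
        _ ≤ |G| * 2 ^ p := mul_le_mul_of_nonneg_right (h1.trans (le_abs_self G)) (by positivity)
        _ ≤ _ := le_add_of_nonneg_right (abs_nonneg _)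
    · rw [Finset.not_nonempty_iff_eq_empty] at h
      rw [h, Nat.cast_one, Real.one_rpow, mul_one]
      exact (le_abs_self _).trans (le_add_of_nonneg_left (by positivity))

/-- A finite infimum in `ℕ∞` is over a non-empty set, hence attained. -/
theorem exists_injOn_of_algorithmicDim_eq {W : Set (Finset ℕ)} {d : ℕ}
    (hd : algorithmicDim W = d) :
    ∃ φ : ℕ → Fin d, ∀ u ∈ W, Set.InjOn φ (u : Set ℕ) := by
  have hne : {q : ℕ∞ | ∃ d : ℕ, q = d ∧ ∃ φ : ℕ → Fin d, ∀ u ∈ W, Set.InjOn φ u}.Nonempty := by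
    by_contra h
    rw [Set.not_nonempty_iff_eq_empty] at h
    rw [algorithmicDim, h, sInf_empty] at hd
    exact ENat.natCast_ne_top d hd.symm
  have hmem := csInf_mem hne
  change algorithmicDim W ∈ _ at hmem
  rw [hd] at hmem
  obtain ⟨d', hdd, φ, hφ⟩ := hmem
  obtain rfl : d = d' := by exact_mod_cast hdd
  exact ⟨φ, hφ⟩

/-- Below the decay, weights decay polynomially along some ordering. -/
theorem exists_isOrdering_of_lt_decay {w : Finset ℕ → ℝ} {p₀ : ℝ} (h : (p₀ : EReal) < decay w) :
    ∃ (p : ℝ) (e : ℕ → Finset ℕ), p₀ < p ∧ IsOrdering w e ∧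
      Tendsto (fun j : ℕ => orderedWeight w e j * ((j : ℝ) + 1) ^ p) atTop (𝓝 0) := by
  obtain ⟨_, ⟨p, rfl, e, he, hlim⟩, hp⟩ := lt_sSup_iff.mp h
  exact ⟨p, e, by exact_mod_cast hp, he, hlim⟩

/-- Solves q > τ/(δ - 1) for δ, so that a real decay rate p with 2 min(1, s)/q + 1 < p can be chosen
below the decay; infinite decay is trivial. -/
theorem add_one_lt_of_div_sub_one_lt {τ q : ℝ} (hq : 0 < q) {δ : EReal} (hδ : 1 < δ)
    (h : (τ : EReal) / (δ - 1) < q) : ((τ / q + 1 : ℝ) : EReal) < δ := by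
  induction δ with
  | bot => exact absurd hδ (by simp)
  | top => exact EReal.coe_lt_top _
  | coe δ =>
    have hδ' : 1 < δ := by exact_mod_cast hδ
    have h' : τ / (δ - 1) < q := by
      rw [← EReal.coe_one, ← EReal.coe_sub, ← EReal.coe_div] at h
      exact_mod_cast h
    rw [div_lt_iff₀ (sub_pos.mpr hδ')] at h'
    have : τ / q < δ - 1 := by
      rw [div_lt_iff₀ hq]
      linarith
    exact_mod_cast lt_sub_iff_add_lt.mp this

end InfDimInt

/-! ### The theorem -/

theorem mainTheorem7
    {D : Set ℝ} (hD : MeasurableSet D) (K : AnchoredKernel D)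
    (ρ : Measure D) [IsProbabilityMeasure ρ]
    (hM : Integrable (fun x => K.toFun x x) ρ)
    (hC₀ : 0 < K.doubleIntegral ρ)
    (γ : Finset ℕ → ℝ≥0)
    (hγ : Summable fun u => (γ u : ℝ) * K.diagIntegral ρ ^ u.card)
    (hactive : ∃ u : Finset ℕ, u.Nonempty ∧ 0 < γ u)
    (price : ℕ → ℝ) (hprice_one : ∀ k, 1 ≤ price k) (hprice_mono : Monotone price)
    (s : ℝ) (hs : 0 ≤ s)
    (hprice : (fun k => price k) =O[atTop] fun k : ℕ => (k : ℝ) ^ s)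
    (W : Set (Finset ℕ)) (hW : ∀ u, 0 < γ u → u ∈ W)
    (d : ℕ) (hd : algorithmicDim W = d)
    (hdecay : 1 < decay fun u => (γ u : ℝ) * K.doubleIntegral ρ ^ u.card)
    (b B α β₁ β₂ : ℝ) (hb : 0 ≤ b) (hB : 0 ≤ B) (hα : 0 < α) (hβ₁ : 0 ≤ β₁) (hβ₂ : 0 ≤ β₂)
    (a : ∀ n : ℕ, Fin n → ℝ) (t : ∀ n : ℕ, Fin n → Fin d → D)
    (hQ : ∀ n : ℕ, 1 ≤ n → ∀ u : Finset (Fin d),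
      K.errorOn ρ u (a n) (t n) ≤ ENNReal.ofReal
        (b * B ^ u.card * ((n : ℝ) + 1) ^ (-α) *
          (1 + Real.log ((n : ℝ) + 1)) ^ (β₁ * u.card + β₂))) :
    exponent K ρ γ price ≤
      max ((1 / α : ℝ) : EReal)
        (((2 * min 1 s : ℝ) : EReal) /
          (decay (fun u => (γ u : ℝ) * K.doubleIntegral ρ ^ u.card) - 1)) := by
  obtain ⟨φ, hφ⟩ := exists_injOn_of_algorithmicDim_eq hd
  have hcard : ∀ u, 0 < γ u → u.card ≤ d := fun u hu => by
    rw [← Finset.card_image_of_injOn (hφ u (hW u hu))]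
    simpa using Finset.card_le_univ (u.image φ)
  have hw : ∀ u, 0 < γ u → 0 < (γ u : ℝ) * K.doubleIntegral ρ ^ u.card := fun u hu =>
    mul_pos (NNReal.coe_pos.mpr hu) (pow_pos hC₀ _)
  -- It suffices that every real q above the maximum is an admissible exponent.
  refine EReal.le_of_forall_lt_iff_le.mp fun q hq => ?_
  obtain ⟨hq1, hq2⟩ := max_lt_iff.mp hq
  have hqα : 1 / α < q := by exact_mod_cast hq1
  have hq0 : 0 < q := lt_trans (by positivity) hqα
  obtain ⟨p, e, hp, he, hlim⟩ :=
    exists_isOrdering_of_lt_decay (add_one_lt_of_div_sub_one_lt hq0 hdecay hq2)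
  have hp0 : 0 ≤ p := by
    have : 0 ≤ 2 * min 1 s / q := by positivity
    linarith
  obtain ⟨J, G, hJ, hJ1, hG0, hG⟩ := he.exists_enumeration hp0 hlim
  obtain ⟨C, hC⟩ := exists_le_mul_rpow_of_isBigO hs hprice
  obtain ⟨α', hα1, hα2⟩ := exists_between ((one_div_lt hα hq0).mp hqα)
  have hα0 : 0 < α' := lt_trans (by positivity) hα1
  obtain ⟨c, hc, hbound⟩ := exists_log_rpow_le hb hB hα0 hα2 hβ₁ hβ₂ d
  -- The errors are weighted by γ_u, the decay by γ_u C₀^|u|; since |u| ≤ d, the former is at most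
  -- M^d times the latter.
  set M := max 1 (K.doubleIntegral ρ)⁻¹ with hMdef
  have hM1 : 1 ≤ M := le_max_left _ _
  have hγM : ∀ u, 0 < γ u → (γ u : ℝ) ≤
      (γ u : ℝ) * K.doubleIntegral ρ ^ u.card * M ^ d := fun u hu => by
    have h1 : 1 ≤ K.doubleIntegral ρ * M := by
      have := mul_le_mul_of_nonneg_left (le_max_right 1 (K.doubleIntegral ρ)⁻¹) hC₀.le
      rwa [mul_inv_cancel₀ hC₀.ne'] at this
    have h2 : 1 ≤ K.doubleIntegral ρ ^ u.card * M ^ u.card := by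
      rw [← mul_pow]
      exact one_le_pow₀ h1
    have h3 : M ^ u.card ≤ M ^ d := pow_le_pow_right₀ hM1 (hcard u hu)
    have h4 := h2.trans (mul_le_mul_of_nonneg_left h3 (pow_pos hC₀ u.card).le)
    rw [mul_assoc]
    exact le_mul_of_one_le_right (γ u).coe_nonneg h4
  have hGJ : ∀ u, 0 ≤ G * (J u : ℝ) ^ (-p) := fun u => by positivity
  -- One family of quadratures on D^d serves all active sets: `t n i ∘ φ` repeats its coordinates
  -- along φ, and on `u` it errs as the original does on the image of `u`.
  obtain ⟨A, hA, hcomp⟩ := K.exists_complexity_le ρ hM hC₀.le γ hγ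
    (J := J) (hJ.mono fun u hu => hw u hu) (fun u _ => hJ1 u) hcard (p := p) (G := G * M ^ d)
    (fun u hu => by
      rw [mul_right_comm]
      exact (hγM u hu).trans (mul_le_mul_of_nonneg_right (hG u (hw u hu)) (by positivity)))
    (fun u hu => by
      rw [mul_right_comm]
      exact (hG u (hw u hu)).trans (le_mul_of_one_le_right (hGJ u) (one_le_pow₀ hM1)))
    hprice_one hprice_mono hs hC a (fun n i => t n i ∘ φ) (α := α') (c := c) hα0
    (fun n hn u hu => by
      rw [K.coordSqError_comp ρ (hφ u (hW u hu))]
      refine (K.errorOn_le_iff ρ hM _ _ _ (by positivity)).mp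
        ((hQ n hn _).trans (ENNReal.ofReal_le_ofReal (hbound n hn _ ?_)))
      exact Finset.card_image_le.trans (hcard u hu))
    (q := q) (by rw [one_div_lt hα0 hq0]; exact hα1) hp
  exact sInf_le ⟨q, rfl, hq0.le, A, hA, hcomp⟩
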